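/- **Notation.** For $f\in L^1(\mathbb R^2)$ real-valued let $\mathcal Rf(t,\vartheta)=\int_{\mathbb R} f(t\cos\vartheta-s\sin\vartheta,\,t\sin\vartheta+s\cos\vartheta)\,ds$ be its Radon transform. For functions of one variable let $\mathcal Fg(S)=\int_{\mathbb R} g(t)e^{-itS}\,dt$ and $\mathcal F^{-1}g(t)=\frac1{2\pi}\int_{\mathbb R} g(S)e^{itS}\,dS$ (acting on the first variable $t$, resp. $S$, of functions on $\mathbb R\times[0,\pi)$), and let $\mathcal Bh(x,y)=\frac1\pi\int_0^\pi h(x\cos\vartheta+y\sin\vartheta,\vartheta)\,d\vartheta$ be the back projection. For a window $W:\mathbb R\to\mathbb R$ and $L>0$ put $A_L(S)=|S|\,W(S/L)$, $$f_L=\tfrac12\,\mathcal B\big(\mathcal F^{-1}[A_L(S)\,\mathcal F(\mathcal Rf)(S,\vartheta)]\big),\qquad K_L=\tfrac12\,\mathcal B(\mathcal F^{-1}A_L),$$ and $A=A_1$, $K=K_1$. For $1\le p\le\infty$ let $\omega_p(g,\delta)=\sup_{\|h\|\le\delta}\|g(\cdot-h)-g\|_{L^p(\mathbb R^2)}$.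 For $0<\theta<1$ let $|g|_{B^{\theta,p}_q}=\big(\int_0^\infty (t^{-\theta}\omega_p(g,t))^q\,\frac{dt}t\big)^{1/q}$ if $1\le q<\infty$ and $|g|_{B^{\theta,p}_\infty}=\sup_{t>0}t^{-\theta}\omega_p(g,t)$. For $\alpha=n+\theta$ with $n\in\mathbb N$, $n\ge1$, $0<\theta<1$, let $$|f|_{B^{\alpha,p}_q}=\sum_{j_1+j_2=n}\frac{n!}{j_1!\,j_2!}\,|f^{(j_1,j_2)}|_{B^{\theta,p}_q},$$ where $f^{(j_1,j_2)}$ are weak derivatives (locally integrable functions; the value is $\infty$ if one of them does not exist), and let $B^{\alpha,p}_q(\mathbb R^2)=\{f\in L^p(\mathbb R^2):|f|_{B^{\alpha,p}_q}<\infty\}$. **Theorem.** Let $1\le p,q\le\infty$, $\alpha=n+\theta$ with $n\in\mathbb N$, $n\ge 1$, $0<\theta<1$, and let $f\in L^1(\mathbb R^2)\cap B^{\alpha,p}_q(\mathbb R^2)$. Let $W\in L^\infty(\mathbb R)$ be even and continuous at $0$ with $W(0)=1$, such that $A\in L^1(\mathbb R)\cap L^2(\mathbb R)$, $K\in L^1(\mathbb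 R^2)$, $$\int_{\mathbb R^2}x^{j_1}y^{j_2}K(x,y)\,d(x,y)=0\quad\text{for all }j_1,j_2\in\mathbb N_0\text{ with }1\le j_1+j_2\le n,$$ and $\int_{\mathbb R^2}\|(x,y)\|^\alpha|K(x,y)|\,d(x,y)<\infty$. Then for every $L>0$ we have $f-f_L\in L^p(\mathbb R^2)$ and $$\|f-f_L\|_{L^p(\mathbb R^2)}\le c_{\theta,q}\,\frac{\Gamma(\theta+1)}{\Gamma(\alpha+1)}\Big(\int_{\mathbb R^2}\|(x,y)\|^\alpha|K(x,y)|\,d(x,y)\Big)L^{-\alpha}\,|f|_{B^{\alpha,p}_q},$$ where $c_{\theta,q}=(2e\theta q)^{1/q}$ for $1\le q<\infty$ and $c_{\theta,\infty}=1$. -/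

import Mathlib

open MeasureTheory
open scoped ENNReal

noncomputable section

namespace FBP

/-- The plane with its Euclidean norm. -/
abbrev Plane : Type := EuclideanSpace ℝ (Fin 2)

/-! ### Besov spaces -/

/-- The classical partial derivative in the `i`-th coordinate direction. -/
def partialDeriv (i : Fin 2) (φ : Plane → ℝ) : Plane → ℝ :=
  fun x => fderiv ℝ φ x (EuclideanSpace.single i 1)

/-- The classical mixed derivative `∂₁^{j₁} ∂₂^{j₂} φ`. -/
def mixedDeriv (j : ℕ × ℕ) (φ : Plane → ℝ) : Plane → ℝ :=
  (partialDeriv 0)^[j.1] ((partialDeriv 1)^[j.2] φ)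

/-- `g` is a weak derivative of `f` of multi-index `j`. -/
def IsWeakDeriv (j : ℕ × ℕ) (f g : Plane → ℝ) : Prop :=
  LocallyIntegrable g volume ∧
    ∀ φ : Plane → ℝ, ContDiff ℝ (⊤ : ℕ∞) φ → HasCompactSupport φ →
      ∫ x, f x * mixedDeriv j φ x = (-1) ^ (j.1 + j.2) * ∫ x, g x * φ x

/-- The `L^p`-modulus of continuity `ω_p(f, δ)`. -/
def modulus (p : ℝ≥0∞) (f : Plane → ℝ) (δ : ℝ) : ℝ≥0∞ :=
  ⨆ (h : Plane) (_ : ‖h‖ ≤ δ), eLpNorm (fun x => f (x - h) - f x) p volume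

open Classical in
/-- The Besov semi-norm of order `0 < θ < 1`, with values in `[0, ∞]`. -/
def besovSeminormFrac (θ : ℝ) (p q : ℝ≥0∞) (f : Plane → ℝ) : ℝ≥0∞ :=
  if q = ∞ then
    ⨆ (t : ℝ) (_ : 0 < t), ENNReal.ofReal (t ^ (-θ)) * modulus p f t
  else
    (∫⁻ t in Set.Ioi (0 : ℝ),
      (ENNReal.ofReal (t ^ (-θ)) * modulus p f t) ^ q.toReal * ENNReal.ofReal t⁻¹) ^ (1 / q.toReal)

/-- The Besov semi-norm of order `n + θ` with `0 < θ < 1`: the sum over the multi-indices `j` of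
length `n` of `n! / (j₁! j₂!)` times the semi-norm of order `θ` of the weak derivative `f^{(j)}`.
The infimum runs over the representatives of the (almost everywhere unique) weak derivative; the
semi-norm does not depend on the representative, and the infimum is `∞` if there is no weak
derivative. -/
def besovSeminorm (n : ℕ) (θ : ℝ) (p q : ℝ≥0∞) (f : Plane → ℝ) : ℝ≥0∞ :=
  ∑ j ∈ Finset.HasAntidiagonal.antidiagonal n,
    (n.choose j.1 : ℝ≥0∞) * ⨅ (g : Plane → ℝ) (_ : IsWeakDeriv j f g), besovSeminormFrac θ p q g

/-- Membership in the Besov space `B^{α,p}_q(ℝ²)` with `α = n + θ`, `0 < θ < 1`. -/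
def MemBesov (n : ℕ) (θ : ℝ) (p q : ℝ≥0∞) (f : Plane → ℝ) : Prop :=
  MemLp f p volume ∧ besovSeminorm n θ p q f < ∞

/-! ### Filtered back projection -/

/-- The Radon transform: the integral of `f` with respect to arc length over the line
`{x | x₁ cos ϑ + x₂ sin ϑ = t}`. -/
def radon (f : Plane → ℝ) (t ϑ : ℝ) : ℝ :=
  ∫ s : ℝ, f !₂[t * Real.cos ϑ - s * Real.sin ϑ, t * Real.sin ϑ + s * Real.cos ϑ]

/-- The Fourier transform on `ℝ`, `𝓕 g (S) = ∫ g(t) e^{-itS} dt`. -/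
def fourier (g : ℝ → ℂ) (S : ℝ) : ℂ :=
  ∫ t : ℝ, g t * Complex.exp (-(Complex.I * t * S))

/-- The inverse Fourier transform on `ℝ`, `𝓕⁻¹ g (t) = (2π)⁻¹ ∫ g(S) e^{itS} dS`. -/
def fourierInv (g : ℝ → ℂ) (t : ℝ) : ℂ :=
  (1 / (2 * Real.pi) : ℂ) * ∫ S : ℝ, g S * Complex.exp (Complex.I * t * S)

/-- The back projection operator. -/
def backProj (h : ℝ → ℝ → ℂ) (x : Plane) : ℂ :=
  (1 / Real.pi : ℂ) * ∫ ϑ in (0 : ℝ)..Real.pi, h (x 0 * Real.cos ϑ + x 1 * Real.sin ϑ) ϑ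

/-- The low-pass filter `A_L(S) = |S| W(S / L)` with window `W` and bandwidth `L`. -/
def lowPass (W : ℝ → ℝ) (L S : ℝ) : ℝ :=
  |S| * W (S / L)

/-- The approximate FBP reconstruction `f_L = ½ 𝓑(𝓕⁻¹[A_L(S) 𝓕(𝓡 f)(S, ϑ)])`. -/
def fbp (W : ℝ → ℝ) (L : ℝ) (f : Plane → ℝ) (x : Plane) : ℂ :=
  (1 / 2 : ℂ) * backProj (fun t ϑ =>
    fourierInv (fun S => (lowPass W L S : ℂ) * fourier (fun s => (radon f s ϑ : ℂ)) S) t) x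

/-- The convolution kernel `K_L = ½ 𝓑(𝓕⁻¹ A_L)`; it is real-valued when `W` is even. -/
def kernel (W : ℝ → ℝ) (L : ℝ) (x : Plane) : ℂ :=
  (1 / 2 : ℂ) * backProj (fun t _ => fourierInv (fun S => (lowPass W L S : ℂ)) t) x

open Classical in
/-- The constant `c_{θ,q}`. -/
def besovConst (θ : ℝ) (q : ℝ≥0∞) : ℝ :=
  if q = ∞ then 1 else (2 * Real.exp 1 * θ * q.toReal) ^ (1 / q.toReal)

end FBP

end

/-! The reconstruction is a convolution, `f_L = f * K_L`. By the Fourier slice theorem the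
one-dimensional transform of `radon f · ϑ` is the plane transform of `f` along the direction `ϑ`,
and Fubini turns the filtered back projection into `∫ f y K_L (x - y) dy` (`fbp_eq_integral`). The
kernel scales as `K_L x = L² K (L x)`, so its moments reduce to those of `K` and its absolute moment
of order `α` produces the factor `L^(-α)`. Its total mass is `W 0 = 1`; since only `K ∈ L¹` is
known, this is obtained by testing against widening Gaussians (`integral_kernel`).

What remains is approximation by a kernel with mass one and vanishing moments up to order `n`. For
smooth `F`, the Taylor polynomial of degree `n` at `x` integrates against the kernel to `F x`, so
the error is the Taylor remainder integrated against the kernel. That remainder is an average over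
`t ∈ (0, 1)`, with density `n (1 - t)^(n-1)`, of increments of the derivatives of order `n` between
`x` and `x - t y`, times `‖y‖^n / n!`. Minkowski's inequality moves the `L^p` norm inside
(`eLpNorm_lintegral_le`), each increment costs `c_{θ,q} ‖t y‖^θ` times a Besov semi-norm
(`modulus_le_besovSeminormFrac`), and the `t`-integral is a Beta integral giving the quotient of
Gamma values.

A general `f` has only weak derivatives, so it is mollified first. Mollification makes weak
derivatives classical, does not increase moduli of continuity, and commutes with the passage to the
error `f - f * K_L`. The bound is therefore uniform in the mollification parameter and survives the
almost everywhere limit by Fatou's lemma (`eLpNorm_sub_convC_le`). -/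

namespace FBP

/-! ### Integral inequalities in `L^p` -/

/-- Jensen's inequality for a lower Lebesgue integral with a weight. -/
theorem lintegral_rpow_le_lintegral_div_rpow {Y : Type*} [MeasurableSpace Y] {ν : Measure Y}
    {r : ℝ} (hr : 1 ≤ r) {g w : Y → ℝ≥0∞} (hg : AEMeasurable g ν) (hw : AEMeasurable w ν)
    (hw0 : ∀ᵐ y ∂ν, w y ≠ 0) (hwt : ∀ᵐ y ∂ν, w y ≠ ∞) :
    (∫⁻ y, g y ∂ν) ^ r ≤ (∫⁻ y, w y * (g y / w y) ^ r ∂ν) * (∫⁻ y, w y ∂ν) ^ (r - 1) := by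
  have hr0 : 0 < r := by linarith
  have hG : AEMeasurable (fun y => g y / w y) ν := hg.div hw
  have hG' : AEStronglyMeasurable (fun y => g y / w y) (ν.withDensity w) :=
    (hG.mono_ac (withDensity_absolutelyContinuous _ _)).aestronglyMeasurable
  -- Comparison of the `L^1` and `L^r` norms of `g / w` for the measure `w dν`. Its total mass
  -- enters with exponent `1 - 1/r`, which becomes `r - 1` after raising to the power `r`.
  have h := eLpNorm'_le_eLpNorm'_mul_rpow_measure_univ (p := 1) (q := r) one_pos hr hG'
  simp only [eLpNorm', enorm_eq_self, ENNReal.rpow_one, div_one] at h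
  rw [lintegral_withDensity_eq_lintegral_mul₀ hw hG,
    lintegral_withDensity_eq_lintegral_mul₀ hw (hG.pow_const r),
    withDensity_apply _ MeasurableSet.univ, Measure.restrict_univ] at h
  simp only [Pi.mul_apply] at h
  have e : ∫⁻ y, w y * (g y / w y) ∂ν = ∫⁻ y, g y ∂ν := by
    refine lintegral_congr_ae ?_
    filter_upwards [hw0, hwt] with y h0 ht
    exact ENNReal.mul_div_cancel h0 ht
  rw [e] at h
  calc (∫⁻ y, g y ∂ν) ^ r ≤ _ := ENNReal.rpow_le_rpow h hr0.le
    _ = _ := by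
      rw [ENNReal.mul_rpow_of_nonneg _ _ hr0.le, ← ENNReal.rpow_mul, ← ENNReal.rpow_mul]
      congr 2
      · rw [one_div_mul_cancel hr0.ne', ENNReal.rpow_one]
      · field_simp

/-- Minkowski's integral inequality, in the form where the `L^p` norms of the slices are dominated
by a positive weight. -/
theorem eLpNorm_lintegral_le {X Y : Type*} [MeasurableSpace X] [MeasurableSpace Y]
    {μ : Measure X} {ν : Measure Y} [SFinite μ] [SFinite ν] {p : ℝ≥0∞} (hp : 1 ≤ p)
    {F : X → Y → ℝ≥0∞} (hF : AEMeasurable (Function.uncurry F) (μ.prod ν))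
    {w : Y → ℝ≥0∞} (hw : AEMeasurable w ν) (hw0 : ∀ᵐ y ∂ν, w y ≠ 0) (hwt : ∀ᵐ y ∂ν, w y ≠ ∞)
    {C : ℝ≥0∞} (h : ∀ᵐ y ∂ν, eLpNorm (fun x => F x y) p μ ≤ C * w y) :
    eLpNorm (fun x => ∫⁻ y, F x y ∂ν) p μ ≤ C * ∫⁻ y, w y ∂ν := by
  by_cases hpt : p = ∞
  · subst hpt
    simp only [eLpNorm_exponent_top] at h ⊢
    refine eLpNormEssSup_le_of_ae_enorm_bound ?_
    -- The bound is known for almost every `y`, then almost every `x`. Exchanging the quantifiers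
    -- needs a measurable set, hence the detour through measurable representatives of `F` and `w`.
    have key : ∀ᵐ x ∂μ, ∀ᵐ y ∂ν, F x y ≤ C * w y := by
      have h1 : ∀ᵐ x ∂μ, ∀ᵐ y ∂ν, F x y = hF.mk _ (x, y) := by
        have := Measure.ae_ae_of_ae_prod hF.ae_eq_mk
        exact this
      have h1' : ∀ᵐ y ∂ν, ∀ᵐ x ∂μ, F x y = hF.mk _ (x, y) := by
        have e := (Measure.measurePreserving_swap (μ := ν) (ν := μ)).quasiMeasurePreserving.ae hF.ae_eq_mk
        exact Measure.ae_ae_of_ae_prod e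
      have h2 : ∀ᵐ x ∂μ, ∀ᵐ y ∂ν, hF.mk _ (x, y) ≤ C * hw.mk _ y := by
        refine (Measure.ae_ae_comm (μ := μ) (ν := ν)
          (p := fun x y => hF.mk _ (x, y) ≤ C * hw.mk _ y) ?_).2 ?_
        · exact measurableSet_le (by simpa using hF.measurable_mk)
            ((hw.measurable_mk.comp measurable_snd).const_mul C)
        · filter_upwards [h1', h, hw.ae_eq_mk] with y a b c
          filter_upwards [a, enorm_ae_le_eLpNormEssSup (fun x => F x y) μ] with x a d
          rw [← a, ← c]
          exact d.trans b
      filter_upwards [h1, h2] with x a b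
      filter_upwards [a, b, hw.ae_eq_mk] with y a b c
      rw [a, c]
      exact b
    filter_upwards [key] with x hx
    rw [enorm_eq_self]
    exact (lintegral_mono_ae hx).trans (lintegral_const_mul'' _ hw).le
  · have hr : 1 ≤ p.toReal := by
      rw [← ENNReal.toReal_one]
      exact ENNReal.toReal_mono hpt hp
    have hp0 : p ≠ 0 := (zero_lt_one.trans_le hp).ne'
    set r := p.toReal
    have hr0 : 0 < r := by linarith
    set M := ∫⁻ y, w y ∂ν
    have hFy : ∀ᵐ x ∂μ, AEMeasurable (F x) ν := by
      have := Measure.ae_ae_of_ae_prod hF.ae_eq_mk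
      filter_upwards [this] with x hx
      exact ⟨fun y => hF.mk _ (x, y), hF.measurable_mk.comp measurable_prodMk_left, hx⟩
    have hm : AEMeasurable (Function.uncurry fun x y => w y * (F x y / w y) ^ r) (μ.prod ν) := by
      have hw' : AEMeasurable (fun z : X × Y => w z.2) (μ.prod ν) := hw.comp_snd
      exact hw'.mul ((hF.div hw').pow_const r)
    rw [eLpNorm_eq_lintegral_rpow_enorm_toReal hp0 hpt]
    rw [one_div, ENNReal.rpow_inv_le_iff hr0]
    simp only [enorm_eq_self]
    -- Jensen in `y` with weight `w`, then Tonelli, then the slice bound. The powers of `w` cancel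
    -- to leave `C ^ r * w y`, and the two factors `M` and `M ^ (r - 1)` combine to `M ^ r`.
    calc ∫⁻ x, (∫⁻ y, F x y ∂ν) ^ r ∂μ
        ≤ ∫⁻ x, (∫⁻ y, w y * (F x y / w y) ^ r ∂ν) * M ^ (r - 1) ∂μ := by
          refine lintegral_mono_ae ?_
          filter_upwards [hFy] with x hx
          exact lintegral_rpow_le_lintegral_div_rpow hr hx hw hw0 hwt
      _ = (∫⁻ y, ∫⁻ x, w y * (F x y / w y) ^ r ∂μ ∂ν) * M ^ (r - 1) := by
          rw [← lintegral_lintegral_swap hm]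
          exact lintegral_mul_const'' _ hm.lintegral_prod_right'
      _ ≤ (∫⁻ y, C ^ r * w y ∂ν) * M ^ (r - 1) := by
          gcongr ?_ * _
          have h1' : ∀ᵐ y ∂ν, AEMeasurable (fun x => F x y) μ := by
            have e := (Measure.measurePreserving_swap (μ := ν) (ν := μ)).quasiMeasurePreserving.ae hF.ae_eq_mk
            filter_upwards [Measure.ae_ae_of_ae_prod e] with y hy
            exact ⟨fun x => hF.mk _ (x, y), hF.measurable_mk.comp measurable_prodMk_right, hy⟩
          refine lintegral_mono_ae ?_
          filter_upwards [h, hw0, hwt, h1'] with y hy h0 ht hmy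
          rw [eLpNorm_eq_lintegral_rpow_enorm_toReal hp0 hpt,
            one_div, ENNReal.rpow_inv_le_iff hr0] at hy
          simp only [enorm_eq_self] at hy
          have e : ∀ x, w y * (F x y / w y) ^ r = (w y * (w y)⁻¹ ^ r) * F x y ^ r := by
            intro x
            rw [div_eq_mul_inv, ENNReal.mul_rpow_of_nonneg _ _ hr0.le]
            ring
          simp_rw [e]
          rw [lintegral_const_mul'' _ (hmy.pow_const r)]
          calc _ ≤ (w y * (w y)⁻¹ ^ r) * (C * w y) ^ r := by gcongr
            _ = (C ^ r * w y) * (((w y)⁻¹ * w y) ^ r) := by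
              rw [ENNReal.mul_rpow_of_nonneg _ _ hr0.le, ENNReal.mul_rpow_of_nonneg _ _ hr0.le]
              ring
            _ = C ^ r * w y := by rw [ENNReal.inv_mul_cancel h0 ht, ENNReal.one_rpow, mul_one]
      _ = (C * M) ^ r := by
          rw [lintegral_const_mul'' _ hw, ENNReal.mul_rpow_of_nonneg _ _ hr0.le, mul_assoc]
          congr 1
          conv_lhs => rw [← ENNReal.rpow_one (∫⁻ y, w y ∂ν)]
          rw [← ENNReal.rpow_add_of_nonneg _ _ zero_le_one (by linarith)]
          congr 1
          ring

/-! ### Moduli of continuity, Besov semi-norms and the Beta integral -/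

theorem modulus_mono (p : ℝ≥0∞) (g : Plane → ℝ) {s t : ℝ} (h : s ≤ t) :
    modulus p g s ≤ modulus p g t :=
  iSup_mono fun _ => iSup_mono' fun hs => ⟨hs.trans h, le_rfl⟩

theorem eLpNorm_translate_sub_le_modulus (p : ℝ≥0∞) (g : Plane → ℝ) (h : Plane) :
    eLpNorm (fun x => g (x - h) - g x) p volume ≤ modulus p g ‖h‖ :=
  le_iSup₂_of_le h le_rfl le_rfl

theorem besovConst_pos {θ : ℝ} (hθ : 0 < θ) {q : ℝ≥0∞} (hq : 1 ≤ q) : 0 < besovConst θ q := by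
  unfold besovConst
  split_ifs with h
  · exact one_pos
  · have : 0 < q.toReal := ENNReal.toReal_pos (zero_lt_one.trans_le hq).ne' h
    positivity

/-- The modulus of continuity is dominated by the Besov semi-norm. -/
theorem modulus_le_besovSeminormFrac {θ : ℝ} (hθ : 0 < θ) {p q : ℝ≥0∞} (hq : 1 ≤ q)
    (g : Plane → ℝ) {t : ℝ} (ht : 0 < t) :
    modulus p g t ≤ ENNReal.ofReal (besovConst θ q * t ^ θ) * besovSeminormFrac θ p q g := by
  have htθ : 0 < t ^ θ := Real.rpow_pos_of_pos ht θ
  have hinv : ENNReal.ofReal (t ^ θ) * ENNReal.ofReal (t ^ (-θ)) = 1 := by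
    rw [← ENNReal.ofReal_mul htθ.le, ← Real.rpow_add ht]
    simp
  by_cases hqt : q = ∞
  · simp only [besovConst, besovSeminormFrac, hqt, if_true, one_mul]
    calc modulus p g t
        = ENNReal.ofReal (t ^ θ) * (ENNReal.ofReal (t ^ (-θ)) * modulus p g t) := by
          rw [← mul_assoc, hinv, one_mul]
      _ ≤ _ := by
          gcongr
          exact le_iSup₂_of_le (f := fun (t : ℝ) (_ : 0 < t) =>
            ENNReal.ofReal (t ^ (-θ)) * modulus p g t) t ht le_rfl
  · have hr0 : 0 < q.toReal := ENNReal.toReal_pos (zero_lt_one.trans_le hq).ne' hqt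
    simp only [besovConst, besovSeminormFrac, hqt, if_false]
    set r := q.toReal
    have hθr : 0 < θ * r := mul_pos hθ hr0
    have hint : ∫⁻ s in Set.Ioi t, ENNReal.ofReal (s ^ (-(θ * r) - 1))
        = ENNReal.ofReal (t ^ (-(θ * r)) / (θ * r)) := by
      rw [← ofReal_integral_eq_lintegral_ofReal
        (integrableOn_Ioi_rpow_of_lt (by linarith) ht)]
      · rw [integral_Ioi_rpow_of_lt (by linarith) ht]
        congr 1
        rw [sub_add_cancel, neg_div_neg_eq]
      · filter_upwards [ae_restrict_mem measurableSet_Ioi] with s hs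
        exact Real.rpow_nonneg (ht.le.trans (le_of_lt hs)) _
    -- The modulus is monotone, so on `s > t` it may be replaced by its value at `t`; the power of
    -- `s` left over is integrated in `hint`.
    have hlow : ENNReal.ofReal (t ^ (-(θ * r)) / (θ * r)) * modulus p g t ^ r ≤
        ∫⁻ s in Set.Ioi (0 : ℝ),
          (ENNReal.ofReal (s ^ (-θ)) * modulus p g s) ^ r * ENNReal.ofReal s⁻¹ := by
      rw [← hint, ← lintegral_mul_const _ (by fun_prop)]
      refine le_trans ?_ (lintegral_mono_set (Set.Ioi_subset_Ioi ht.le))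
      refine setLIntegral_mono' measurableSet_Ioi fun s hs => ?_
      have hs0 : 0 < s := ht.trans hs
      rw [ENNReal.mul_rpow_of_nonneg _ _ hr0.le, mul_right_comm,
        ENNReal.ofReal_rpow_of_nonneg (Real.rpow_nonneg hs0.le _) hr0.le,
        ← ENNReal.ofReal_mul (by positivity), ← Real.rpow_mul hs0.le, ← Real.rpow_neg_one s,
        ← Real.rpow_add hs0]
      have e : -(θ * r) - 1 = -θ * r + -1 := by ring
      rw [e]
      gcongr
      exact modulus_mono p g (le_of_lt hs)
    -- The argument so far yields the constant `(θ r)^(1/r)`; the factor `2e` in the stated constant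
    -- enters only through `2e ≥ 1`.
    have hone : (1 : ℝ≥0∞) ≤ ENNReal.ofReal ((2 * Real.exp 1 * θ * r) ^ (1 / r) * t ^ θ) ^ r *
        ENNReal.ofReal (t ^ (-(θ * r)) / (θ * r)) := by
      rw [ENNReal.ofReal_rpow_of_nonneg (by positivity) hr0.le,
        ← ENNReal.ofReal_mul (by positivity), ← ENNReal.ofReal_one]
      refine ENNReal.ofReal_le_ofReal ?_
      rw [Real.mul_rpow (by positivity) htθ.le, ← Real.rpow_mul (by positivity),
        ← Real.rpow_mul ht.le, one_div_mul_cancel hr0.ne', Real.rpow_one, Real.rpow_neg ht.le]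
      have h1 : t ^ (θ * r) ≠ 0 := (Real.rpow_pos_of_pos ht _).ne'
      have h2 : 2 * Real.exp 1 * θ * r * t ^ (θ * r) * ((t ^ (θ * r))⁻¹ / (θ * r))
          = 2 * Real.exp 1 := by field_simp
      rw [h2]
      have := Real.add_one_le_exp (1 : ℝ)
      linarith
    set I := ∫⁻ s in Set.Ioi (0 : ℝ),
          (ENNReal.ofReal (s ^ (-θ)) * modulus p g s) ^ r * ENNReal.ofReal s⁻¹
    rw [← ENNReal.rpow_le_rpow_iff hr0, ENNReal.mul_rpow_of_nonneg _ _ hr0.le,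
      ← ENNReal.rpow_mul I, one_div_mul_cancel hr0.ne', ENNReal.rpow_one]
    calc modulus p g t ^ r = 1 * modulus p g t ^ r := (one_mul _).symm
      _ ≤ _ := mul_le_mul_left hone _
      _ ≤ _ := by rw [mul_assoc]; exact mul_le_mul_right hlow _

/-- The Beta integral with one integral exponent. -/
theorem lintegral_one_sub_pow_mul_rpow {n : ℕ} (hn : 1 ≤ n) {θ : ℝ} (hθ : 0 < θ) :
    ∫⁻ s in Set.Ioc (0 : ℝ) 1, ENNReal.ofReal (n * (1 - s) ^ (n - 1) * s ^ θ)
      = ENNReal.ofReal (n.factorial * (Real.Gamma (θ + 1) / Real.Gamma (n + θ + 1))) := by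
  have hint : IntervalIntegrable (fun s : ℝ => n * (1 - s) ^ (n - 1) * s ^ θ) volume 0 1 := by
    apply Continuous.intervalIntegrable
    have : Continuous fun s : ℝ => s ^ θ := Real.continuous_rpow_const hθ.le
    fun_prop
  rw [← ofReal_integral_eq_lintegral_ofReal
    ((intervalIntegrable_iff_integrableOn_Ioc_of_le zero_le_one).1 hint)]
  · congr 1
    rw [← intervalIntegral.integral_of_le zero_le_one]
    have hb := Complex.betaIntegral_eq_Gamma_mul_div ((θ + 1 : ℝ) : ℂ) ((n : ℝ) : ℂ)
      (by simp only [Complex.ofReal_re]; linarith) (by simp; omega)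
    rw [← Complex.ofReal_add, Complex.Gamma_ofReal, Complex.Gamma_ofReal, Complex.Gamma_ofReal,
      Complex.betaIntegral] at hb
    have e : ∫ x : ℝ in 0..1, (x : ℂ) ^ (((θ + 1 : ℝ) : ℂ) - 1) * (1 - (x : ℂ)) ^ (((n : ℝ) : ℂ) - 1)
        = ((∫ x : ℝ in 0..1, (1 - x) ^ (n - 1) * x ^ θ : ℝ) : ℂ) := by
      rw [← intervalIntegral.integral_ofReal]
      refine intervalIntegral.integral_congr fun x hx => ?_
      rw [Set.uIcc_of_le zero_le_one] at hx
      have h1 : (((n : ℝ) : ℂ) - 1) = ((n - 1 : ℕ) : ℂ) := by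
        rw [Nat.cast_sub hn]; simp
      have h2 : (((θ + 1 : ℝ) : ℂ) - 1) = (θ : ℂ) := by push_cast; ring
      simp only [h1, h2, Complex.cpow_natCast]
      rw [← Complex.ofReal_cpow hx.1]
      push_cast
      ring
    rw [e] at hb
    have hb' : (∫ x : ℝ in 0..1, (1 - x) ^ (n - 1) * x ^ θ)
        = Real.Gamma (θ + 1) * Real.Gamma n / Real.Gamma (θ + 1 + n) := by exact_mod_cast hb
    simp_rw [mul_assoc]
    rw [intervalIntegral.integral_const_mul, hb']
    have hG : Real.Gamma n = (n - 1).factorial := by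
      rw [← Real.Gamma_nat_eq_factorial, Nat.cast_sub hn]; simp
    have hf : (n.factorial : ℝ) = n * (n - 1).factorial := by
      rw [← Nat.cast_mul, Nat.mul_factorial_pred (by omega)]
    rw [hG, hf, show θ + 1 + n = n + θ + 1 by ring]
    ring
  · filter_upwards [ae_restrict_mem measurableSet_Ioc] with s hs
    have := Real.rpow_nonneg hs.1.le θ
    have := pow_nonneg (sub_nonneg.2 hs.2) (n - 1)
    simp only [Pi.zero_apply]
    positivity

open scoped Convolution

/-! ### Mixed derivatives of smooth functions -/

section MixedDeriv

variable {φ F : Plane → ℝ}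

theorem contDiff_partialDeriv (hφ : ContDiff ℝ (⊤ : ℕ∞) φ) (i : Fin 2) :
    ContDiff ℝ (⊤ : ℕ∞) (partialDeriv i φ) :=
  (hφ.fderiv_right (m := (⊤ : ℕ∞)) (by simp)).clm_apply contDiff_const

theorem contDiff_iterate_partialDeriv (hφ : ContDiff ℝ (⊤ : ℕ∞) φ) (i : Fin 2) (k : ℕ) :
    ContDiff ℝ (⊤ : ℕ∞) ((partialDeriv i)^[k] φ) := by
  induction k with
  | zero => exact hφ
  | succ k ih =>
    rw [Function.iterate_succ_apply']
    exact contDiff_partialDeriv ih i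

theorem contDiff_mixedDeriv (hφ : ContDiff ℝ (⊤ : ℕ∞) φ) (j : ℕ × ℕ) :
    ContDiff ℝ (⊤ : ℕ∞) (mixedDeriv j φ) :=
  contDiff_iterate_partialDeriv (contDiff_iterate_partialDeriv hφ 1 j.2) 0 j.1

theorem hasCompactSupport_iterate_partialDeriv (hφ : HasCompactSupport φ) (i : Fin 2) (k : ℕ) :
    HasCompactSupport ((partialDeriv i)^[k] φ) := by
  induction k with
  | zero => exact hφ
  | succ k ih =>
    rw [Function.iterate_succ_apply']
    exact ih.fderiv_apply ℝ _

theorem fderiv_apply_eq_partialDeriv (φ : Plane → ℝ) (x y : Plane) :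
    fderiv ℝ φ x y = y 0 * partialDeriv 0 φ x + y 1 * partialDeriv 1 φ x := by
  have hy : y = y 0 • EuclideanSpace.single (0 : Fin 2) (1 : ℝ)
      + y 1 • EuclideanSpace.single (1 : Fin 2) (1 : ℝ) := by
    ext i
    fin_cases i <;> simp
  conv_lhs => rw [hy]
  rw [map_add, map_smul, map_smul]
  rfl

theorem partialDeriv_comm (hφ : ContDiff ℝ (⊤ : ℕ∞) φ) (i j : Fin 2) :
    partialDeriv i (partialDeriv j φ) = partialDeriv j (partialDeriv i φ) := by
  have hd : Differentiable ℝ (fderiv ℝ φ) :=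
    (hφ.fderiv_right (m := (⊤ : ℕ∞)) (by simp)).differentiable (by simp)
  have key : ∀ (x v w : Plane), fderiv ℝ (fun z => fderiv ℝ φ z v) x w
      = fderiv ℝ (fderiv ℝ φ) x w v := by
    intro x v w
    rw [fderiv_clm_apply (hd x) (differentiableAt_const v)]
    simp
  ext x
  unfold partialDeriv
  rw [key, key]
  exact (hφ.contDiffAt.isSymmSndFDerivAt (by
    simp only [minSmoothness_of_isRCLikeNormedField]; exact WithTop.coe_le_coe.2 le_top)) _ _

theorem partialDeriv_one_iterate_partialDeriv_zero (hφ : ContDiff ℝ (⊤ : ℕ∞) φ) (k : ℕ) :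
    partialDeriv 1 ((partialDeriv 0)^[k] φ) = (partialDeriv 0)^[k] (partialDeriv 1 φ) := by
  induction k with
  | zero => rfl
  | succ k ih =>
    rw [Function.iterate_succ_apply', partialDeriv_comm (contDiff_iterate_partialDeriv hφ 0 k),
      ih, Function.iterate_succ_apply']

theorem partialDeriv_zero_mixedDeriv (φ : Plane → ℝ) (i j : ℕ) :
    partialDeriv 0 (mixedDeriv (i, j) φ) = mixedDeriv (i + 1, j) φ := by
  simp only [mixedDeriv, Function.iterate_succ_apply']

theorem partialDeriv_one_mixedDeriv (hφ : ContDiff ℝ (⊤ : ℕ∞) φ) (i j : ℕ) :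
    partialDeriv 1 (mixedDeriv (i, j) φ) = mixedDeriv (i, j + 1) φ := by
  simp only [mixedDeriv]
  rw [partialDeriv_one_iterate_partialDeriv_zero (contDiff_iterate_partialDeriv hφ 1 j),
    Function.iterate_succ_apply' (partialDeriv 1)]

/-- The iterated derivative on the diagonal in terms of mixed partial derivatives. -/
theorem iteratedFDeriv_apply_eq_sum_mixedDeriv (hF : ContDiff ℝ (⊤ : ℕ∞) F) (k : ℕ) (x y : Plane) :
    iteratedFDeriv ℝ k F x (fun _ => y) = ∑ j ∈ Finset.HasAntidiagonal.antidiagonal k,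
      (k.choose j.1 : ℝ) * (y 0 ^ j.1 * y 1 ^ j.2 * mixedDeriv j F x) := by
  induction k generalizing x with
  | zero => simp [mixedDeriv]
  | succ k ih =>
    have hd : DifferentiableAt ℝ (iteratedFDeriv ℝ k F) x :=
      (hF.differentiable_iteratedFDeriv (m := k) (by exact_mod_cast ENat.natCast_lt_top k)) x
    rw [hd.iteratedFDeriv_succ_apply_left']
    have e : (fun z => iteratedFDeriv ℝ k F z (Fin.tail fun _ : Fin (k + 1) => y))
        = fun z => ∑ j ∈ Finset.HasAntidiagonal.antidiagonal k,
          (k.choose j.1 : ℝ) * (y 0 ^ j.1 * y 1 ^ j.2 * mixedDeriv j F z) := by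
      ext z
      exact ih z
    have hdm : ∀ j, DifferentiableAt ℝ (mixedDeriv j F) x := fun j =>
      (contDiff_mixedDeriv hF j).differentiable (by simp) x
    rw [e, fderiv_fun_sum fun j _ => ((hdm j).const_mul _).const_mul _]
    simp only [sum_apply]
    -- Pascal's rule splits the sum of order `k + 1` into the two contributions of differentiating
    -- once more in each coordinate.
    rw [Finset.sum_antidiagonal_choose_succ_mul
      (fun a b => y 0 ^ a * y 1 ^ b * mixedDeriv (a, b) F x), ← Finset.sum_add_distrib]
    refine Finset.sum_congr rfl fun j hj => ?_
    rw [fderiv_const_mul ((hdm j).const_mul _), fderiv_const_mul (hdm j)]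
    simp only [smul_apply, smul_eq_mul, fderiv_apply_eq_partialDeriv]
    obtain ⟨a, b⟩ := j
    rw [partialDeriv_zero_mixedDeriv, partialDeriv_one_mixedDeriv hF]
    have hc : k.choose b = k.choose a := by
      rw [Finset.HasAntidiagonal.mem_antidiagonal] at hj
      exact (Nat.choose_symm_of_eq_add (by simpa [add_comm] using hj.symm))
    simp only [hc]
    ring

/-- Each derivative of a reflected function contributes a sign. The constant `c` is carried so that
the rule applies a second time, to the signed function left by the first coordinate. -/
theorem iterate_partialDeriv_const_sub (hφ : ContDiff ℝ (⊤ : ℕ∞) φ) (i : Fin 2) (k : ℕ) (c : ℝ)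
    (x : Plane) : (partialDeriv i)^[k] (fun y => c * φ (x - y))
      = fun y => (-1) ^ k * c * (partialDeriv i)^[k] φ (x - y) := by
  induction k with
  | zero => simp
  | succ k ih =>
    rw [Function.iterate_succ_apply', Function.iterate_succ_apply', ih]
    have hd : Differentiable ℝ ((partialDeriv i)^[k] φ) :=
      (contDiff_iterate_partialDeriv hφ i k).differentiable (by simp)
    ext y
    have h1 : HasFDerivAt (fun y => (partialDeriv i)^[k] φ (x - y))
        ((fderiv ℝ ((partialDeriv i)^[k] φ) (x - y)).comp (-ContinuousLinearMap.id ℝ Plane)) y :=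
      (hd (x - y)).hasFDerivAt.comp y ((hasFDerivAt_id y).const_sub x)
    have h2 := (h1.const_mul ((-1) ^ k * c)).fderiv
    unfold partialDeriv at h2 ⊢
    rw [h2]
    simp
    ring

theorem mixedDeriv_const_sub (hφ : ContDiff ℝ (⊤ : ℕ∞) φ) (j : ℕ × ℕ) (x : Plane) :
    mixedDeriv j (fun y => φ (x - y)) = fun y => (-1) ^ (j.1 + j.2) * mixedDeriv j φ (x - y) := by
  unfold mixedDeriv
  have h := iterate_partialDeriv_const_sub hφ 1 j.2 1 x
  simp only [one_mul, mul_one] at h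
  rw [h, iterate_partialDeriv_const_sub (contDiff_iterate_partialDeriv hφ 1 j.2) 0 j.1]
  ext y
  rw [pow_add]

end MixedDeriv

/-! ### Mollification -/

section Mollification

variable {φ f g : Plane → ℝ}

/-- The convolution of two real-valued functions on the plane. -/
noncomputable abbrev conv (φ f : Plane → ℝ) : Plane → ℝ := φ ⋆[ContinuousLinearMap.lsmul ℝ ℝ, volume] f

theorem conv_apply (φ f : Plane → ℝ) (x : Plane) : conv φ f x = ∫ y, φ y * f (x - y) := rfl

theorem conv_apply_swap (φ f : Plane → ℝ) (x : Plane) : conv φ f x = ∫ y, f y * φ (x - y) := by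
  rw [conv, convolution_eq_swap]
  simp [mul_comm]

theorem contDiff_conv (hφ : ContDiff ℝ (⊤ : ℕ∞) φ) (hc : HasCompactSupport φ)
    (hf : LocallyIntegrable f volume) : ContDiff ℝ (⊤ : ℕ∞) (conv φ f) :=
  hc.contDiff_convolution_left _ hφ hf

theorem partialDeriv_conv (hφ : ContDiff ℝ (⊤ : ℕ∞) φ) (hc : HasCompactSupport φ)
    (hf : LocallyIntegrable f volume) (i : Fin 2) :
    partialDeriv i (conv φ f) = conv (partialDeriv i φ) f := by
  ext x
  have h1 : ContDiff ℝ 1 φ := hφ.of_le (by exact_mod_cast le_top)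
  unfold partialDeriv conv
  rw [← convolution_flip,
    (hc.hasFDerivAt_convolution_right (ContinuousLinearMap.lsmul ℝ ℝ).flip hf h1 x).fderiv,
    convolution_precompR_apply _ hf (hc.fderiv ℝ) (h1.continuous_fderiv one_ne_zero),
    convolution_flip]

theorem iterate_partialDeriv_conv (hφ : ContDiff ℝ (⊤ : ℕ∞) φ) (hc : HasCompactSupport φ)
    (hf : LocallyIntegrable f volume) (i : Fin 2) (k : ℕ) :
    (partialDeriv i)^[k] (conv φ f) = conv ((partialDeriv i)^[k] φ) f := by
  induction k with
  | zero => rfl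
  | succ k ih =>
    rw [Function.iterate_succ_apply', Function.iterate_succ_apply', ih,
      partialDeriv_conv (contDiff_iterate_partialDeriv hφ i k)
        (hasCompactSupport_iterate_partialDeriv hc i k) hf]

theorem mixedDeriv_conv (hφ : ContDiff ℝ (⊤ : ℕ∞) φ) (hc : HasCompactSupport φ)
    (hf : LocallyIntegrable f volume) (j : ℕ × ℕ) :
    mixedDeriv j (conv φ f) = conv (mixedDeriv j φ) f := by
  unfold mixedDeriv
  rw [iterate_partialDeriv_conv hφ hc hf,
    iterate_partialDeriv_conv (contDiff_iterate_partialDeriv hφ 1 j.2)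
      (hasCompactSupport_iterate_partialDeriv hc 1 j.2) hf]

/-- Mollification turns weak derivatives into classical ones. -/
theorem IsWeakDeriv.mixedDeriv_conv {j : ℕ × ℕ} (h : IsWeakDeriv j f g)
    (hφ : ContDiff ℝ (⊤ : ℕ∞) φ) (hc : HasCompactSupport φ) (hf : LocallyIntegrable f volume) :
    mixedDeriv j (conv φ f) = conv φ g := by
  rw [FBP.mixedDeriv_conv hφ hc hf]
  ext x
  rw [conv_apply_swap, conv_apply_swap]
  -- The test function is the reflected mollifier; the sign from differentiating the reflection
  -- cancels the one in the definition of the weak derivative.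
  have h1 := h.2 (fun y => φ (x - y)) (hφ.comp (contDiff_const.sub contDiff_id))
    (hc.comp_homeomorph (Homeomorph.subLeft x))
  rw [mixedDeriv_const_sub hφ] at h1
  have e : ∀ y, f y * ((-1) ^ (j.1 + j.2) * mixedDeriv j φ (x - y))
      = (-1) ^ (j.1 + j.2) * (f y * mixedDeriv j φ (x - y)) := fun y => by ring
  simp_rw [e] at h1
  rw [integral_const_mul] at h1
  exact mul_left_cancel₀ (pow_ne_zero _ (by norm_num)) h1

/-- Mollification does not increase the modulus of continuity. -/
theorem modulus_conv_le {p : ℝ≥0∞} (hp : 1 ≤ p) (hφ : Continuous φ) (hc : HasCompactSupport φ)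
    (h0 : ∀ x, 0 ≤ φ x) (h1 : ∫ x, φ x = 1) (hg : LocallyIntegrable g volume) (t : ℝ) :
    modulus p (conv φ g) t ≤ modulus p g t := by
  refine iSup₂_le fun h hh => le_trans ?_ (le_iSup₂_of_le h hh le_rfl)
  set d : Plane → ℝ := fun x => g (x - h) - g x with hd
  have hgm : AEStronglyMeasurable g volume := hg.aestronglyMeasurable
  have hdm : AEStronglyMeasurable d volume :=
    (hgm.comp_measurePreserving (measurePreserving_sub_right volume h)).sub hgm
  have hex : ConvolutionExists φ g (ContinuousLinearMap.lsmul ℝ ℝ) volume :=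
    hc.convolutionExists_left _ hφ hg
  have hφm : Measurable fun y => ENNReal.ofReal (φ y) := hφ.measurable.ennreal_ofReal
  -- `φ dy` is a probability measure, and the increment of `conv φ g` is the average of translates
  -- of `d` against it. Minkowski with constant weight `1` applies, all translates having the same
  -- norm.
  set ν : Measure Plane := volume.withDensity fun y => ENNReal.ofReal (φ y) with hν
  have hνac : ν ≪ volume := withDensity_absolutelyContinuous _ _
  have hdm2 : AEMeasurable (fun z : Plane × Plane => d (z.1 - z.2)) (volume.prod volume) :=
    hdm.aemeasurable.comp_quasiMeasurePreserving
      (quasiMeasurePreserving_sub volume volume)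
  have hmeas : AEMeasurable (Function.uncurry fun x y : Plane => ‖d (x - y)‖ₑ)
      (volume.prod ν) :=
    (hdm2.enorm).mono_ac (Measure.AbsolutelyContinuous.rfl.prod hνac)
  have hpt : ∀ x, ‖conv φ g (x - h) - conv φ g x‖ₑ ≤ ∫⁻ y, ‖d (x - y)‖ₑ ∂ν := by
    intro x
    have e : conv φ g (x - h) - conv φ g x = ∫ y, φ y * d (x - y) := by
      rw [conv, convolution, convolution, ← integral_sub (hex _) (hex _)]
      refine integral_congr_ae (Filter.Eventually.of_forall fun y => ?_)
      simp only [hd, ContinuousLinearMap.lsmul_apply, smul_eq_mul]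
      rw [sub_right_comm, mul_sub]
    rw [e]
    refine (enorm_integral_le_lintegral_enorm _).trans ?_
    rw [hν, lintegral_withDensity_eq_lintegral_mul₀ hφm.aemeasurable]
    · refine lintegral_mono fun y => ?_
      rw [Pi.mul_apply, enorm_mul, Real.enorm_eq_ofReal (h0 y)]
    · exact (hdm.comp_quasiMeasurePreserving
        (quasiMeasurePreserving_sub_left_of_right_invariant volume x)).enorm
  have hν1 : ∫⁻ _, 1 ∂ν = 1 := by
    rw [lintegral_one, hν, withDensity_apply _ MeasurableSet.univ, Measure.restrict_univ,
      ← ofReal_integral_eq_lintegral_ofReal (hφ.integrable_of_hasCompactSupport hc)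
        (Filter.Eventually.of_forall h0), h1, ENNReal.ofReal_one]
  calc eLpNorm (fun x => conv φ g (x - h) - conv φ g x) p volume
      ≤ eLpNorm (fun x => ∫⁻ y, ‖d (x - y)‖ₑ ∂ν) p volume :=
        eLpNorm_mono_enorm fun x => by simpa using hpt x
    _ ≤ eLpNorm d p volume * ∫⁻ _, 1 ∂ν := by
        refine eLpNorm_lintegral_le hp hmeas aemeasurable_const (by simp) (by simp)
          (Filter.Eventually.of_forall fun y => ?_)
        rw [mul_one]
        have := eLpNorm_comp_measurePreserving (p := p) hdm
          (measurePreserving_sub_right volume y)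
        rw [← this]
        exact le_of_eq (eLpNorm_enorm _)
    _ = eLpNorm d p volume := by rw [hν1, mul_one]

/-- Boundedness of the mollified function makes its product with an integrable kernel integrable. -/
theorem norm_conv_le (hφ : Continuous φ) (hc : HasCompactSupport φ) (hf : Integrable f volume) :
    ∃ C, ∀ x, ‖conv φ f x‖ ≤ C := by
  obtain ⟨C, hC⟩ := hc.exists_bound_of_continuous hφ
  refine ⟨∫ y, ‖f y‖ * C, fun x => ?_⟩
  rw [conv_apply_swap]
  refine norm_integral_le_of_norm_le (hf.norm.mul_const C)
    (Filter.Eventually.of_forall fun y => ?_)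
  rw [norm_mul]
  gcongr
  exact hC _

end Mollification

open Complex in
theorem norm_exp_I_mul_real (a : ℝ) : ‖exp (I * a)‖ = 1 := by
  rw [mul_comm]; exact norm_exp_ofReal_mul_I a

/-! ### The Fourier slice theorem -/

/-- The rotation of the plane by the angle `ϑ`. -/
noncomputable def rotation (ϑ : ℝ) : Plane →ₗᵢ[ℝ] Plane where
  toFun x := !₂[x 0 * Real.cos ϑ - x 1 * Real.sin ϑ, x 0 * Real.sin ϑ + x 1 * Real.cos ϑ]
  map_add' x y := by
    ext i
    fin_cases i <;> simp <;> ring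
  map_smul' c x := by
    ext i
    fin_cases i <;> simp <;> ring
  norm_map' x := by
    simp only [EuclideanSpace.norm_eq, Fin.sum_univ_two, Real.norm_eq_abs, sq_abs]
    congr 1
    simp
    linear_combination (x 0 ^ 2 + x 1 ^ 2) * Real.sin_sq_add_cos_sq ϑ

/-- Coordinates of the plane adapted to the lines with normal angle `ϑ`. -/
noncomputable def lineCoords (ϑ : ℝ) : ℝ × ℝ ≃ᵐ Plane :=
  (MeasurableEquiv.finTwoArrow.symm.trans (MeasurableEquiv.toLp 2 (Fin 2 → ℝ))).trans
    ((rotation ϑ).toLinearIsometryEquiv rfl).toHomeomorph.toMeasurableEquiv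

theorem lineCoords_apply (ϑ t s : ℝ) : lineCoords ϑ (t, s) =
    !₂[t * Real.cos ϑ - s * Real.sin ϑ, t * Real.sin ϑ + s * Real.cos ϑ] := rfl

theorem measurePreserving_lineCoords (ϑ : ℝ) :
    MeasurePreserving (lineCoords ϑ) (volume.prod volume) volume :=
  (((rotation ϑ).toLinearIsometryEquiv rfl).measurePreserving.comp
    (EuclideanSpace.volume_preserving_symm_measurableEquiv_toLp (Fin 2)).symm).comp
      (volume_preserving_finTwoArrow ℝ).symm

-- Fourier slice theorem: in the rotated coordinates `(t, s)` the phase depends on `t` alone, so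
-- Fubini integrates out `s` first and leaves the Radon transform.
open Complex in
theorem fourier_radon {f : Plane → ℝ} (hf : Integrable f volume) (ϑ S : ℝ) :
    fourier (fun s => (radon f s ϑ : ℂ)) S = ∫ y : Plane, (f y : ℂ) *
      exp (-(I * ((y 0 * Real.cos ϑ + y 1 * Real.sin ϑ : ℝ) : ℂ) * S)) := by
  set G : Plane → ℂ := fun y => (f y : ℂ) *
    exp (-(I * ((y 0 * Real.cos ϑ + y 1 * Real.sin ϑ : ℝ) : ℂ) * S)) with hG
  have hGi : Integrable G volume := by
    refine hf.ofReal.mul_bdd (c := 1) ?_ (Filter.Eventually.of_forall fun y => ?_)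
    · exact Continuous.aestronglyMeasurable (by fun_prop)
    · rw [show -(I * ((y 0 * Real.cos ϑ + y 1 * Real.sin ϑ : ℝ) : ℂ) * S)
        = I * ((-(y 0 * Real.cos ϑ + y 1 * Real.sin ϑ) * S : ℝ) : ℂ) by push_cast; ring,
        norm_exp_I_mul_real]
  have hmp := measurePreserving_lineCoords ϑ
  have hGi' : Integrable (fun z : ℝ × ℝ => G (lineCoords ϑ z)) (volume.prod volume) :=
    (hmp.integrable_comp_emb (lineCoords ϑ).measurableEmbedding).2 hGi
  rw [← hmp.integral_comp (lineCoords ϑ).measurableEmbedding, integral_prod _ hGi']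
  unfold fourier radon
  refine integral_congr_ae (Filter.Eventually.of_forall fun t => ?_)
  simp only
  rw [← integral_complex_ofReal, ← integral_mul_const]
  refine integral_congr_ae (Filter.Eventually.of_forall fun s => ?_)
  simp only [hG, lineCoords_apply]
  congr 4
  simp only [Matrix.cons_val_zero, Matrix.cons_val_one]
  have h : (t * Real.cos ϑ - s * Real.sin ϑ) * Real.cos ϑ
      + (t * Real.sin ϑ + s * Real.cos ϑ) * Real.sin ϑ = t := by
    linear_combination t * Real.sin_sq_add_cos_sq ϑ
  rw [h]

/-! ### The convolution kernel -/

theorem lowPass_eq (W : ℝ → ℝ) {L : ℝ} (hL : 0 < L) (S : ℝ) :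
    lowPass W L S = L * lowPass W 1 (S / L) := by
  simp only [lowPass, div_one, abs_div, abs_of_pos hL]
  field_simp

theorem integrable_lowPass {W : ℝ → ℝ} (hA : Integrable (lowPass W 1) volume) {L : ℝ}
    (hL : 0 < L) : Integrable (lowPass W L) volume := by
  rw [show lowPass W L = fun S => L * lowPass W 1 (S / L) from funext (lowPass_eq W hL)]
  exact (hA.comp_div hL.ne').const_mul L

-- Under the substitution `S ↦ S / L`, the factor `|S|` and the measure `dS` contribute one power of
-- `L` each.
open Complex in
theorem kernel_eq (W : ℝ → ℝ) {L : ℝ} (hL : 0 < L) (x : Plane) :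
    kernel W L x = (L : ℂ) ^ 2 * kernel W 1 (L • x) := by
  have h : ∀ t : ℝ, fourierInv (fun S => (lowPass W L S : ℂ)) t
      = (L : ℂ) ^ 2 * fourierInv (fun S => (lowPass W 1 S : ℂ)) (L * t) := by
    intro t
    unfold fourierInv
    have e := Measure.integral_comp_div
      (fun S : ℝ => (L : ℂ) * (lowPass W 1 S * exp (I * ((L * t : ℝ) : ℂ) * S))) L
    have e2 : ∀ S : ℝ, (L : ℂ) * (lowPass W 1 (S / L) *
        exp (I * ((L * t : ℝ) : ℂ) * ((S / L : ℝ) : ℂ)))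
        = lowPass W L S * exp (I * t * S) := by
      intro S
      rw [lowPass_eq W hL S]
      have hLc : (L : ℂ) ≠ 0 := ofReal_ne_zero.2 hL.ne'
      have : I * ((L * t : ℝ) : ℂ) * ((S / L : ℝ) : ℂ) = I * t * S := by
        push_cast
        field_simp
      rw [this]
      push_cast
      ring
    simp only [e2] at e
    rw [e, integral_const_mul, abs_of_pos hL, real_smul]
    push_cast
    ring
  unfold kernel backProj
  simp only [h, intervalIntegral.integral_const_mul, PiLp.smul_apply, smul_eq_mul]
  simp only [show ∀ ϑ : ℝ, L * x 0 * Real.cos ϑ + L * x 1 * Real.sin ϑ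
    = L * (x 0 * Real.cos ϑ + x 1 * Real.sin ϑ) from fun ϑ => by ring]
  ring

open Complex in
/-- Convolution with the kernel in the Fourier domain. -/
theorem integral_mul_kernel {W : ℝ → ℝ} {L : ℝ} (hA : Integrable (lowPass W L) volume)
    {g : Plane → ℂ} (hg : Integrable g volume) (x : Plane) :
    ∫ y, g y * kernel W L (x - y) = (1 / 2 : ℂ) * ((1 / Real.pi : ℂ) * ∫ ϑ in (0 : ℝ)..Real.pi,
      (1 / (2 * Real.pi) : ℂ) * ∫ S : ℝ, (lowPass W L S : ℂ) *
        (∫ y : Plane, g y * exp (-(I * ((y 0 * Real.cos ϑ + y 1 * Real.sin ϑ : ℝ) : ℂ) * S))) *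
        exp (I * ((x 0 * Real.cos ϑ + x 1 * Real.sin ϑ : ℝ) : ℂ) * S)) := by
  set m : Measure ℝ := volume.restrict (Set.Ioc 0 Real.pi) with hm
  set E : Plane → ℝ × ℝ → ℂ := fun y z =>
    exp (I * (((x - y) 0 * Real.cos z.1 + (x - y) 1 * Real.sin z.1 : ℝ) : ℂ) * z.2) with hE
  have hE1 : ∀ y z, ‖E y z‖ = 1 := by
    intro y z
    rw [hE]
    simp only
    rw [mul_assoc, ← ofReal_mul]
    exact norm_exp_I_mul_real _
  have hEc : Continuous (Function.uncurry E) := by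
    rw [hE]
    unfold Function.uncurry
    fun_prop
  have ha : Integrable (fun z : ℝ × ℝ => (lowPass W L z.2 : ℂ)) (m.prod volume) := by
    have h1 : Integrable (fun _ : ℝ => (1 : ℂ)) m := integrable_const _
    simpa using h1.mul_prod (hA.ofReal (𝕜 := ℂ))
  -- The exponential has modulus one and the angle ranges over a bounded interval, so `|g|` times
  -- the filter dominates the integrand and Fubini applies.
  have hΦ : Integrable (Function.uncurry fun y z => g y * (lowPass W L z.2 * E y z))
      (volume.prod (m.prod volume)) := by
    have h1 := (hg.mul_prod ha).mul_bdd (c := 1) hEc.aestronglyMeasurable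
      (Filter.Eventually.of_forall fun w => (hE1 w.1 w.2).le)
    refine h1.congr (Filter.Eventually.of_forall fun w => ?_)
    simp only [Function.uncurry]
    ring
  have hin : ∀ y, Integrable (fun z : ℝ × ℝ => lowPass W L z.2 * E y z) (m.prod volume) :=
    fun y => ha.mul_bdd (c := 1) (hEc.comp (by fun_prop : Continuous fun z => (y, z))).aestronglyMeasurable
      (Filter.Eventually.of_forall fun w => (hE1 y w).le)
  have hk : ∀ y, kernel W L (x - y) = (1 / 2 : ℂ) * ((1 / Real.pi : ℂ) * ((1 / (2 * Real.pi) : ℂ) *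
      ∫ z, lowPass W L z.2 * E y z ∂(m.prod volume))) := by
    intro y
    unfold kernel backProj fourierInv
    rw [intervalIntegral.integral_const_mul, intervalIntegral.integral_of_le Real.pi_pos.le,
      integral_prod _ (hin y)]
  have hswap := integral_integral_swap hΦ
  have hz : ∀ z : ℝ × ℝ, ∫ y, g y * (lowPass W L z.2 * E y z) = (lowPass W L z.2 : ℂ) *
        (∫ y : Plane, g y *
          exp (-(I * ((y 0 * Real.cos z.1 + y 1 * Real.sin z.1 : ℝ) : ℂ) * z.2))) *
        exp (I * ((x 0 * Real.cos z.1 + x 1 * Real.sin z.1 : ℝ) : ℂ) * z.2) := by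
    intro z
    rw [mul_comm (lowPass W L z.2 : ℂ), mul_assoc, ← integral_mul_const]
    refine integral_congr_ae (Filter.Eventually.of_forall fun y => ?_)
    have : E y z = exp (-(I * ((y 0 * Real.cos z.1 + y 1 * Real.sin z.1 : ℝ) : ℂ) * z.2)) *
        exp (I * ((x 0 * Real.cos z.1 + x 1 * Real.sin z.1 : ℝ) : ℂ) * z.2) := by
      rw [← exp_add, hE]
      simp only [PiLp.sub_apply]
      congr 1
      push_cast
      ring
    simp only [this]
    ring
  have hint := hΦ.integral_prod_right
  simp only [Function.uncurry] at hint
  simp only [hz] at hswap hint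
  rw [integral_prod _ hint] at hswap
  rw [intervalIntegral.integral_const_mul, intervalIntegral.integral_of_le Real.pi_pos.le,
    ← hswap]
  simp only [integral_const_mul] at *
  rw [← integral_const_mul, ← integral_const_mul, ← integral_const_mul]
  refine integral_congr_ae (Filter.Eventually.of_forall fun y => ?_)
  simp only [hk]
  ring

/-- The approximate reconstruction is the convolution of `f` with the kernel. -/
theorem fbp_eq_integral {W : ℝ → ℝ} {L : ℝ} (hA : Integrable (lowPass W L) volume)
    {f : Plane → ℝ} (hf : Integrable f volume) (x : Plane) :
    fbp W L f x = ∫ y, (f y : ℂ) * kernel W L (x - y) := by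
  have h := integral_mul_kernel hA (hf.ofReal (𝕜 := ℂ)) x
  simp only [Complex.coe_algebraMap] at h
  refine Eq.trans ?_ h.symm
  unfold fbp backProj fourierInv
  simp only [fourier_radon hf]

/-! ### The total mass of the kernel -/

open Complex in
theorem integral_gaussian_mul_exp (ε : ℝ) (hε : 0 < ε) (ϑ S : ℝ) :
    ∫ y : Plane, exp (-ε * ‖y‖ ^ 2) *
        exp (-(I * ((y 0 * Real.cos ϑ + y 1 * Real.sin ϑ : ℝ) : ℂ) * S))
      = (Real.pi / ε) * exp (-(S ^ 2 / (4 * ε))) := by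
  have h := GaussianFourier.integral_cexp_neg_mul_sq_norm_add (b := ε) (V := Plane)
    (by simpa using hε) (-(I * S)) !₂[Real.cos ϑ, Real.sin ϑ]
  have hn : ‖(!₂[Real.cos ϑ, Real.sin ϑ] : Plane)‖ ^ 2 = 1 := by
    rw [EuclideanSpace.norm_sq_eq]
    simp
  have hn' : (‖(!₂[Real.cos ϑ, Real.sin ϑ] : Plane)‖ : ℂ) ^ 2 = 1 := by exact_mod_cast hn
  rw [hn', finrank_euclideanSpace, Fintype.card_fin] at h
  have e1 : ((2 : ℕ) : ℂ) / 2 = 1 := by norm_num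
  rw [e1, cpow_one] at h
  have e2 : (-(I * S)) ^ 2 * 1 / (4 * (ε : ℂ)) = -(S ^ 2 / (4 * ε)) := by
    rw [neg_sq, mul_pow, I_sq]
    ring
  rw [e2] at h
  rw [← h]
  refine integral_congr_ae (Filter.Eventually.of_forall fun y => ?_)
  simp only
  rw [← exp_add]
  congr 1
  simp only [PiLp.inner_apply, Fin.sum_univ_two, Matrix.cons_val_zero,
    Matrix.cons_val_one, RCLike.inner_apply, conj_trivial]
  push_cast
  ring

-- The Gaussian transform is radial, so the angular integral is just `π`. After `S = δ u` the
-- filter's `|S|` and `dS` absorb the `δ^(-2)` of the transform, and `δ` survives only inside `W`.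
-- The constant is `1/4 = (1/2) · (1/π) · π · (1/(2π)) · π`.
open Complex in
theorem integral_gaussian_mul_kernel {W : ℝ → ℝ} (hA : Integrable (lowPass W 1) volume)
    {δ : ℝ} (hδ : 0 < δ) :
    ∫ y : Plane, exp (-(δ ^ 2 : ℝ) * ‖y‖ ^ 2) * kernel W 1 (0 - y)
      = (1 / 4 : ℂ) * ∫ u : ℝ, ((|u| * Real.exp (-(u ^ 2 / 4)) * W (δ * u) : ℝ) : ℂ) := by
  have hδ2 : 0 < δ ^ 2 := by positivity
  have hg : Integrable (fun y : Plane => exp (-(δ ^ 2 : ℝ) * ‖y‖ ^ 2)) volume := by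
    have := GaussianFourier.integrable_cexp_neg_mul_sq_norm_add (b := ((δ ^ 2 : ℝ) : ℂ))
      (V := Plane) (by rw [ofReal_re]; exact hδ2) 0 0
    simpa using this
  rw [integral_mul_kernel hA hg]
  simp only [integral_gaussian_mul_exp _ hδ2]
  simp only [PiLp.zero_apply, zero_mul, add_zero, ofReal_zero, mul_zero, exp_zero, mul_one]
  rw [intervalIntegral.integral_const]
  have hs := Measure.integral_comp_mul_left
    (fun S : ℝ => (lowPass W 1 S : ℂ) * ((Real.pi / (δ ^ 2 : ℝ)) *
      exp (-(S ^ 2 / (4 * (δ ^ 2 : ℝ)))))) δ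
  have hpt : ∀ u : ℝ, (lowPass W 1 (δ * u) : ℂ) * ((Real.pi / (δ ^ 2 : ℝ)) *
      exp (-(((δ * u : ℝ) : ℂ) ^ 2 / (4 * (δ ^ 2 : ℝ)))))
      = (Real.pi / δ) * ((|u| * Real.exp (-(u ^ 2 / 4)) * W (δ * u) : ℝ) : ℂ) := by
    intro u
    have hδc : (δ : ℂ) ≠ 0 := ofReal_ne_zero.2 hδ.ne'
    have e : -(((δ * u : ℝ) : ℂ) ^ 2 / (4 * (δ ^ 2 : ℝ))) = ((-(u ^ 2 / 4) : ℝ) : ℂ) := by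
      push_cast
      field_simp
    rw [e, ← ofReal_exp]
    simp only [lowPass, div_one, abs_mul, abs_of_pos hδ]
    push_cast
    field_simp
  simp only [hpt] at hs
  rw [integral_const_mul, abs_of_pos (inv_pos.2 hδ), real_smul] at hs
  have hδc : (δ : ℂ) ≠ 0 := ofReal_ne_zero.2 hδ.ne'
  have hπ : (Real.pi : ℂ) ≠ 0 := ofReal_ne_zero.2 Real.pi_ne_zero
  have hs' : ∫ S : ℝ, (lowPass W 1 S : ℂ) * ((Real.pi / (δ ^ 2 : ℝ)) *
      exp (-(S ^ 2 / (4 * (δ ^ 2 : ℝ)))))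
      = Real.pi * ∫ u : ℝ, ((|u| * Real.exp (-(u ^ 2 / 4)) * W (δ * u) : ℝ) : ℂ) := by
    set J := ∫ S : ℝ, (lowPass W 1 S : ℂ) * ((Real.pi / (δ ^ 2 : ℝ)) *
      exp (-(S ^ 2 / (4 * (δ ^ 2 : ℝ)))))
    set J' := ∫ u : ℝ, ((|u| * Real.exp (-(u ^ 2 / 4)) * W (δ * u) : ℝ) : ℂ)
    rw [ofReal_inv] at hs
    field_simp at hs
    exact hs.symm
  rw [hs', real_smul]
  push_cast
  field_simp
  ring

theorem integral_abs_mul_exp : ∫ u : ℝ, |u| * Real.exp (-(u ^ 2 / 4)) = 4 := by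
  have h := integral_comp_abs (f := fun u => u * Real.exp (-(u ^ 2 / 4)))
  simp only [sq_abs] at h
  rw [h]
  have h2 := integral_mul_cexp_neg_mul_sq (b := ((1 / 4 : ℝ) : ℂ)) (by norm_num)
  have h3 : ∫ r : ℝ in Set.Ioi 0, (r : ℂ) * Complex.exp (-((1 / 4 : ℝ) : ℂ) * r ^ 2)
      = ((∫ r : ℝ in Set.Ioi 0, r * Real.exp (-(r ^ 2 / 4)) : ℝ) : ℂ) := by
    rw [← integral_complex_ofReal]
    refine integral_congr_ae (Filter.Eventually.of_forall fun r => ?_)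
    simp only
    push_cast
    congr 2
    ring
  rw [h3] at h2
  have h4 : ∫ r : ℝ in Set.Ioi 0, r * Real.exp (-(r ^ 2 / 4)) = (2 * (1 / 4))⁻¹ := by
    exact_mod_cast h2
  rw [h4]
  norm_num

theorem integrable_abs_mul_exp :
    Integrable (fun u : ℝ => |u| * Real.exp (-(u ^ 2 / 4))) volume := by
  have h := (integrable_mul_exp_neg_mul_sq (b := 1 / 4) (by norm_num)).norm
  refine h.congr (Filter.Eventually.of_forall fun u => ?_)
  simp only [norm_mul, Real.norm_eq_abs, Real.abs_exp]
  congr 2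
  ring

open Filter Topology in
/-- The kernel has total mass `W 0 = 1`. -/
theorem integral_kernel {W : ℝ → ℝ} (hW : MemLp W ∞ volume) (hW0 : W 0 = 1)
    (hWc : ContinuousAt W 0) (hA : Integrable (lowPass W 1) volume)
    (hK : Integrable (kernel W 1) volume) : ∫ x, kernel W 1 x = 1 := by
  set δ : ℕ → ℝ := fun k => 1 / ((k : ℝ) + 1) with hδ
  have hδ0 : ∀ k, 0 < δ k := fun k => by positivity
  have hδl : Tendsto δ atTop (𝓝 0) := tendsto_one_div_add_atTop_nhds_zero_nat
  have hK' : Integrable (fun y => kernel W 1 (0 - y)) volume := hK.comp_sub_left 0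
  -- As `δ → 0` the Gaussians increase to `1` and the left side tends to the mass of the kernel. On
  -- the right side, `h2`, the window tends to `W 0` by continuity at the origin.
  have h1 : Tendsto (fun k => ∫ y : Plane, Complex.exp (-((δ k) ^ 2 : ℝ) * ‖y‖ ^ 2) *
      kernel W 1 (0 - y)) atTop (𝓝 (∫ y, kernel W 1 (0 - y))) := by
    refine tendsto_integral_of_dominated_convergence (fun y => ‖kernel W 1 (0 - y)‖) ?_ hK'.norm
      ?_ ?_
    · intro k
      refine AEStronglyMeasurable.mul ?_ hK'.aestronglyMeasurable
      exact Continuous.aestronglyMeasurable (by fun_prop)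
    · refine fun k => Eventually.of_forall fun y => ?_
      rw [norm_mul]
      refine mul_le_of_le_one_left (norm_nonneg _) ?_
      rw [Complex.norm_exp, Real.exp_le_one_iff]
      have e : (-((δ k ^ 2 : ℝ) : ℂ) * (‖y‖ : ℂ) ^ 2).re = -(δ k ^ 2 * ‖y‖ ^ 2) := by
        rw [← Complex.ofReal_pow, ← Complex.ofReal_neg, ← Complex.ofReal_mul, Complex.ofReal_re]
        ring
      rw [e]
      have : 0 ≤ δ k ^ 2 * ‖y‖ ^ 2 := by positivity
      linarith
    · refine Eventually.of_forall fun y => ?_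
      have hc : Continuous fun d : ℝ => Complex.exp (-((d ^ 2 : ℝ) : ℂ) * (‖y‖ : ℂ) ^ 2) *
        kernel W 1 (0 - y) := by fun_prop
      have := (hc.tendsto 0).comp hδl
      simpa [Function.comp_def] using this
  have hbd : ∀ᵐ u : ℝ, ‖W u‖ ≤ (eLpNorm W ∞ volume).toReal := by
    rw [eLpNorm_exponent_top]
    filter_upwards [enorm_ae_le_eLpNormEssSup W volume] with u hu
    rw [← toReal_enorm]
    exact ENNReal.toReal_mono (by simpa using hW.2.ne) hu
  have h2 : Tendsto (fun k => ∫ u : ℝ, |u| * Real.exp (-(u ^ 2 / 4)) * W (δ k * u)) atTop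
      (𝓝 (∫ u : ℝ, |u| * Real.exp (-(u ^ 2 / 4)) * 1)) := by
    -- `W` is bounded and measurable only up to null sets, so these properties must be transported
    -- along the dilation.
    have hq : ∀ k, Measure.QuasiMeasurePreserving (fun u : ℝ => δ k * u) volume volume := fun k =>
      ⟨by fun_prop, by
        rw [Real.map_volume_mul_left (hδ0 k).ne']
        exact Measure.smul_absolutelyContinuous⟩
    refine tendsto_integral_of_dominated_convergence
      (fun u => |u| * Real.exp (-(u ^ 2 / 4)) * (eLpNorm W ∞ volume).toReal) ?_
      (integrable_abs_mul_exp.mul_const _) ?_ ?_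
    · intro k
      exact integrable_abs_mul_exp.aestronglyMeasurable.mul
        (hW.1.comp_quasiMeasurePreserving (hq k))
    · intro k
      filter_upwards [(hq k).ae hbd] with u hu
      rw [norm_mul, Real.norm_of_nonneg (by positivity)]
      gcongr
    · refine Eventually.of_forall fun u => ?_
      have hc : Tendsto (fun k => δ k * u) atTop (𝓝 0) := by simpa using hδl.mul_const u
      have := hWc.tendsto.comp hc
      rw [hW0] at this
      exact this.const_mul _
  simp only [mul_one] at h2
  rw [integral_abs_mul_exp] at h2
  have h3 : Tendsto (fun k => ∫ y : Plane, Complex.exp (-((δ k) ^ 2 : ℝ) * ‖y‖ ^ 2) *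
      kernel W 1 (0 - y)) atTop (𝓝 ((1 / 4 : ℂ) * ((4 : ℝ) : ℂ))) := by
    simp_rw [fun k => integral_gaussian_mul_kernel hA (hδ0 k), integral_complex_ofReal]
    exact ((Complex.continuous_ofReal.tendsto _).comp h2).const_mul _
  have h4 := tendsto_nhds_unique h1 h3
  rw [integral_sub_left_eq_self] at h4
  rw [h4]
  norm_num

/-! ### Taylor expansion against a kernel with vanishing moments -/

theorem abs_coord_le_norm (y : Plane) (i : Fin 2) : |y i| ≤ ‖y‖ :=
  PiLp.norm_apply_le y i

/-- Integrability of the kernel and of its moment of order `n + θ` thereby controls every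
intermediate moment. -/
theorem pow_norm_le_one_add_rpow {n m : ℕ} (hm : m ≤ n) {θ : ℝ} (hθ : 0 ≤ θ) {r : ℝ} (hr : 0 ≤ r) :
    r ^ m ≤ 1 + r ^ (n + θ : ℝ) := by
  have h0 : 0 ≤ r ^ (n + θ : ℝ) := Real.rpow_nonneg hr _
  rcases le_total r 1 with h | h
  · linarith [pow_le_one₀ (n := m) hr h]
  · have : r ^ m ≤ r ^ (n + θ : ℝ) := by
      rw [← Real.rpow_natCast]
      refine Real.rpow_le_rpow_of_exponent_le h ?_
      have : (m : ℝ) ≤ n := by exact_mod_cast hm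
      linarith
    linarith

theorem integrable_monomial_mul {n : ℕ} {θ : ℝ} (hθ : 0 ≤ θ) {k : Plane → ℂ}
    (hk : Integrable k volume) (hkα : Integrable (fun y => ‖y‖ ^ (n + θ : ℝ) * ‖k y‖) volume)
    {a b : ℕ} (hab : a + b ≤ n) :
    Integrable (fun y : Plane => ((y 0 ^ a * y 1 ^ b : ℝ) : ℂ) * k y) volume := by
  refine (hk.norm.add hkα).mono' ?_ (Filter.Eventually.of_forall fun y => ?_)
  · refine AEStronglyMeasurable.mul ?_ hk.aestronglyMeasurable
    exact Continuous.aestronglyMeasurable (by fun_prop)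
  · rw [norm_mul, Complex.norm_real, norm_mul, norm_pow, norm_pow, Real.norm_eq_abs,
      Real.norm_eq_abs]
    have h1 : |y 0| ^ a * |y 1| ^ b ≤ ‖y‖ ^ (a + b) := by
      rw [pow_add]
      gcongr
      · exact abs_coord_le_norm y 0
      · exact abs_coord_le_norm y 1
    have h2 := h1.trans (pow_norm_le_one_add_rpow hab hθ (norm_nonneg y))
    calc _ ≤ (1 + ‖y‖ ^ (n + θ : ℝ)) * ‖k y‖ := by gcongr
      _ = _ := by simp only [Pi.add_apply]; ring

/-- The Taylor polynomial of degree `n` of `F` at `x`, evaluated at `x - y`. -/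
noncomputable def taylorPoly (n : ℕ) (F : Plane → ℝ) (x y : Plane) : ℝ :=
  ∑ m ∈ Finset.range (n + 1), (m.factorial : ℝ)⁻¹ * iteratedFDeriv ℝ m F x (fun _ => -y)

theorem taylorPoly_eq {F : Plane → ℝ} (hF : ContDiff ℝ (⊤ : ℕ∞) F) (n : ℕ) (x y : Plane) :
    taylorPoly n F x y = ∑ m ∈ Finset.range (n + 1),
      ∑ j ∈ Finset.HasAntidiagonal.antidiagonal m,
        ((m.factorial : ℝ)⁻¹ * m.choose j.1 * (-1) ^ (j.1 + j.2) * mixedDeriv j F x) *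
          (y 0 ^ j.1 * y 1 ^ j.2) := by
  refine Finset.sum_congr rfl fun m _ => ?_
  rw [iteratedFDeriv_apply_eq_sum_mixedDeriv hF, Finset.mul_sum]
  refine Finset.sum_congr rfl fun j _ => ?_
  rw [PiLp.neg_apply, PiLp.neg_apply, neg_pow (y 0), neg_pow (y 1), pow_add]
  ring

section Moments

variable {n : ℕ} {θ : ℝ} {k : Plane → ℂ} {F : Plane → ℝ}

theorem integrable_taylorPoly_mul (hF : ContDiff ℝ (⊤ : ℕ∞) F) (hθ : 0 ≤ θ)
    (hk : Integrable k volume) (hkα : Integrable (fun y => ‖y‖ ^ (n + θ : ℝ) * ‖k y‖) volume)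
    (x : Plane) : Integrable (fun y => (taylorPoly n F x y : ℂ) * k y) volume := by
  simp only [taylorPoly_eq hF, Complex.ofReal_sum, Finset.sum_mul]
  refine integrable_finsetSum _ fun m hm => integrable_finsetSum _ fun j hj => ?_
  rw [Finset.HasAntidiagonal.mem_antidiagonal] at hj
  rw [Finset.mem_range] at hm
  simp only [Complex.ofReal_mul _ (_ * _ : ℝ), mul_assoc]
  simpa only [Complex.ofReal_mul, mul_assoc] using
    ((integrable_monomial_mul (a := j.1) (b := j.2) hθ hk hkα (by omega)).const_mul
      (((m.factorial : ℝ)⁻¹ * m.choose j.1 * (-1) ^ (j.1 + j.2) * mixedDeriv j F x : ℝ) : ℂ))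

theorem integral_taylorPoly_mul (hF : ContDiff ℝ (⊤ : ℕ∞) F) (hθ : 0 ≤ θ)
    (hk : Integrable k volume) (hkα : Integrable (fun y => ‖y‖ ^ (n + θ : ℝ) * ‖k y‖) volume)
    (hk1 : ∫ y, k y = 1)
    (hmom : ∀ j₁ j₂ : ℕ, 1 ≤ j₁ + j₂ → j₁ + j₂ ≤ n →
      ∫ y : Plane, ((y 0 ^ j₁ * y 1 ^ j₂ : ℝ) : ℂ) * k y = 0)
    (x : Plane) : ∫ y, (taylorPoly n F x y : ℂ) * k y = F x := by
  have e : ∀ y, (taylorPoly n F x y : ℂ) * k y = ∑ m ∈ Finset.range (n + 1),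
      ∑ j ∈ Finset.HasAntidiagonal.antidiagonal m,
        (((m.factorial : ℝ)⁻¹ * m.choose j.1 * (-1) ^ (j.1 + j.2) * mixedDeriv j F x : ℝ) : ℂ) *
          (((y 0 ^ j.1 * y 1 ^ j.2 : ℝ) : ℂ) * k y) := by
    intro y
    simp only [taylorPoly_eq hF, Complex.ofReal_sum, Finset.sum_mul]
    refine Finset.sum_congr rfl fun m _ => Finset.sum_congr rfl fun j _ => ?_
    rw [Complex.ofReal_mul _ (_ * _ : ℝ), mul_assoc]
  have hi : ∀ m ∈ Finset.range (n + 1), ∀ j ∈ Finset.HasAntidiagonal.antidiagonal m,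
      Integrable (fun y : Plane =>
        (((m.factorial : ℝ)⁻¹ * m.choose j.1 * (-1) ^ (j.1 + j.2) * mixedDeriv j F x : ℝ) : ℂ) *
          (((y 0 ^ j.1 * y 1 ^ j.2 : ℝ) : ℂ) * k y)) volume := by
    intro m hm j hj
    rw [Finset.HasAntidiagonal.mem_antidiagonal] at hj
    rw [Finset.mem_range] at hm
    exact (integrable_monomial_mul hθ hk hkα (by omega)).const_mul _
  simp only [e]
  rw [integral_finsetSum _ fun m hm => integrable_finsetSum _ (hi m hm)]
  -- All terms of positive degree vanish by the moment conditions; the constant term is `F x` times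
  -- the mass of `k`.
  rw [Finset.sum_eq_single 0]
  · simp [mixedDeriv, integral_const_mul, hk1]
  · intro m hm hm0
    rw [integral_finsetSum _ (hi m hm)]
    refine Finset.sum_eq_zero fun j hj => ?_
    rw [Finset.HasAntidiagonal.mem_antidiagonal] at hj
    rw [Finset.mem_range] at hm
    rw [integral_const_mul, hmom j.1 j.2 (by omega) (by omega), mul_zero]
  · simp

end Moments

/-! ### The remainder -/

/-- The weighted sum of the increments of the derivatives of order `n`. -/
noncomputable def derivIncrement (n : ℕ) (F : Plane → ℝ) (x h : Plane) : ℝ :=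
  ∑ j ∈ Finset.HasAntidiagonal.antidiagonal n,
    (n.choose j.1 : ℝ) * ‖mixedDeriv j F (x - h) - mixedDeriv j F x‖

theorem derivIncrement_nonneg (n : ℕ) (F : Plane → ℝ) (x h : Plane) :
    0 ≤ derivIncrement n F x h :=
  Finset.sum_nonneg fun _ _ => by positivity

theorem continuous_derivIncrement {F : Plane → ℝ} (hF : ContDiff ℝ (⊤ : ℕ∞) F) (n : ℕ) :
    Continuous (Function.uncurry (derivIncrement n F)) := by
  have h : ∀ j, Continuous (mixedDeriv j F) := fun j => (contDiff_mixedDeriv hF j).continuous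
  unfold Function.uncurry derivIncrement
  refine continuous_finsetSum _ fun j _ => ?_
  have := h j
  fun_prop

/-- This is the integral remainder of order `n - 1` with the degree `n` term subtracted under the
integral, which is possible because `n (1 - t)^(n-1)` has integral one over `(0, 1)`. In this form
only increments of derivatives of order `n` appear, so fractional regularity suffices. -/
theorem sub_taylorPoly_eq {F : Plane → ℝ} (hF : ContDiff ℝ (⊤ : ℕ∞) F) {n : ℕ} (hn : 1 ≤ n)
    (x y : Plane) : F (x - y) - taylorPoly n F x y =
      ∫ t in (0 : ℝ)..1, (n.factorial : ℝ)⁻¹ * (n * (1 - t) ^ (n - 1)) *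
        (iteratedFDeriv ℝ n F (x - t • y) (fun _ => -y) - iteratedFDeriv ℝ n F x (fun _ => -y)) := by
  obtain ⟨N, rfl⟩ : ∃ N, n = N + 1 := ⟨n - 1, by omega⟩
  have h := map_add_eq_sum_add_integral_iteratedFDeriv (f := F) (x := x) (y := -y) (n := N)
    fun t _ => hF.contDiffAt.of_le (by exact_mod_cast le_top)
  simp only [smul_neg, ← sub_eq_add_neg, smul_eq_mul] at h
  have hc : Continuous fun t : ℝ => iteratedFDeriv ℝ (N + 1) F (x - t • y) (fun _ => -y) := by
    simp only [iteratedFDeriv_apply_eq_sum_mixedDeriv hF]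
    refine continuous_finsetSum _ fun j _ => ?_
    have := (contDiff_mixedDeriv hF j).continuous
    fun_prop
  have hfac : ((N + 1).factorial : ℝ)⁻¹ * ((N + 1 : ℕ) : ℝ) = (N.factorial : ℝ)⁻¹ := by
    rw [Nat.factorial_succ]
    have : (N.factorial : ℝ) ≠ 0 := by positivity
    push_cast
    field_simp
  have hone : ∫ t in (0 : ℝ)..1, (1 - t) ^ N = ((N : ℝ) + 1)⁻¹ := by
    rw [intervalIntegral.integral_comp_sub_left (fun t => t ^ N) 1]
    simp
  rw [taylorPoly, Finset.sum_range_succ, ← sub_sub, h, add_sub_cancel_left]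
  simp only [Nat.add_sub_cancel]
  have e : ∀ t : ℝ, ((N + 1).factorial : ℝ)⁻¹ * (((N + 1 : ℕ) : ℝ) * (1 - t) ^ N) *
      (iteratedFDeriv ℝ (N + 1) F (x - t • y) (fun _ => -y)
        - iteratedFDeriv ℝ (N + 1) F x (fun _ => -y))
      = (N.factorial : ℝ)⁻¹ * ((1 - t) ^ N *
          iteratedFDeriv ℝ (N + 1) F (x - t • y) (fun _ => -y))
        - (N.factorial : ℝ)⁻¹ * iteratedFDeriv ℝ (N + 1) F x (fun _ => -y) * (1 - t) ^ N := by
    intro t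
    rw [← mul_assoc, hfac]
    ring
  simp only [e]
  rw [intervalIntegral.integral_sub, intervalIntegral.integral_const_mul,
    intervalIntegral.integral_const_mul, hone, ← hfac]
  · have : ((N : ℝ) + 1) ≠ 0 := by positivity
    push_cast
    field_simp
  · exact Continuous.intervalIntegrable (by fun_prop) _ _
  · exact Continuous.intervalIntegrable (by fun_prop) _ _

/-- Each monomial of degree `n` is at most `‖y‖ ^ n`; the binomial coefficients of the diagonal
derivative are those of the Besov semi-norm. -/
theorem norm_iteratedFDeriv_sub_le {F : Plane → ℝ} (hF : ContDiff ℝ (⊤ : ℕ∞) F) (n : ℕ)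
    (x h y : Plane) :
    ‖iteratedFDeriv ℝ n F (x - h) (fun _ => -y) - iteratedFDeriv ℝ n F x (fun _ => -y)‖
      ≤ ‖y‖ ^ n * derivIncrement n F x h := by
  rw [iteratedFDeriv_apply_eq_sum_mixedDeriv hF, iteratedFDeriv_apply_eq_sum_mixedDeriv hF,
    ← Finset.sum_sub_distrib, derivIncrement, Finset.mul_sum]
  refine norm_sum_le_of_le _ fun j hj => ?_
  rw [Finset.HasAntidiagonal.mem_antidiagonal] at hj
  rw [← mul_sub, ← mul_sub, norm_mul, norm_mul, norm_mul, norm_pow, norm_pow, PiLp.neg_apply,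
    PiLp.neg_apply, norm_neg, norm_neg, Real.norm_natCast]
  have h1 : ‖y 0‖ ^ j.1 * ‖y 1‖ ^ j.2 ≤ ‖y‖ ^ n := by
    rw [← hj, pow_add]
    gcongr
    · exact abs_coord_le_norm y 0
    · exact abs_coord_le_norm y 1
  calc _ ≤ (n.choose j.1 : ℝ) * (‖y‖ ^ n * ‖mixedDeriv j F (x - h) - mixedDeriv j F x‖) := by
        gcongr
    _ = _ := by ring

theorem enorm_sub_taylorPoly_le {F : Plane → ℝ} (hF : ContDiff ℝ (⊤ : ℕ∞) F) {n : ℕ} (hn : 1 ≤ n)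
    (x y : Plane) : ‖F (x - y) - taylorPoly n F x y‖ₑ ≤ ∫⁻ t in Set.Ioc (0 : ℝ) 1,
      ENNReal.ofReal ((n.factorial : ℝ)⁻¹ * (n * (1 - t) ^ (n - 1)) * ‖y‖ ^ n) *
        ‖derivIncrement n F x (t • y)‖ₑ := by
  rw [sub_taylorPoly_eq hF hn, intervalIntegral.integral_of_le zero_le_one]
  refine (enorm_integral_le_lintegral_enorm _).trans ?_
  refine setLIntegral_mono' measurableSet_Ioc fun t ht => ?_
  have h0 : 0 ≤ (1 - t) ^ (n - 1) := pow_nonneg (sub_nonneg.2 ht.2) _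
  rw [Real.enorm_eq_ofReal (derivIncrement_nonneg _ _ _ _), ← ENNReal.ofReal_mul (by positivity),
    ← ofReal_norm]
  refine ENNReal.ofReal_le_ofReal ?_
  rw [norm_mul, Real.norm_of_nonneg (by positivity), mul_assoc _ (‖y‖ ^ n)]
  gcongr
  exact norm_iteratedFDeriv_sub_le hF n x _ y

theorem eLpNorm_derivIncrement_le {F : Plane → ℝ} (hF : ContDiff ℝ (⊤ : ℕ∞) F) {n : ℕ} {θ : ℝ}
    {p : ℝ≥0∞} (hp : 1 ≤ p) {C : ℕ × ℕ → ℝ≥0∞}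
    (hC : ∀ j ∈ Finset.HasAntidiagonal.antidiagonal n, ∀ t : ℝ, 0 < t →
      modulus p (mixedDeriv j F) t ≤ C j * ENNReal.ofReal (t ^ θ)) {h : Plane} (hh : h ≠ 0) :
    eLpNorm (fun x => derivIncrement n F x h) p volume ≤
      (∑ j ∈ Finset.HasAntidiagonal.antidiagonal n, (n.choose j.1 : ℝ≥0∞) * C j) *
        ENNReal.ofReal (‖h‖ ^ θ) := by
  have hc : ∀ j, Continuous (mixedDeriv j F) := fun j => (contDiff_mixedDeriv hF j).continuous
  have e : (fun x => derivIncrement n F x h) = ∑ j ∈ Finset.HasAntidiagonal.antidiagonal n,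
      (n.choose j.1 : ℝ) • fun x => ‖mixedDeriv j F (x - h) - mixedDeriv j F x‖ := by
    ext x
    simp [derivIncrement]
  rw [e, Finset.sum_mul]
  refine (eLpNorm_sum_le (fun j _ => ?_) hp).trans (Finset.sum_le_sum fun j hj => ?_)
  · have := hc j
    exact Continuous.aestronglyMeasurable (by fun_prop)
  · rw [eLpNorm_const_smul, eLpNorm_norm, mul_assoc]
    have hcast : ‖(n.choose j.1 : ℝ)‖ₑ = (n.choose j.1 : ℝ≥0∞) := by
      rw [Real.enorm_eq_ofReal (by positivity), ENNReal.ofReal_natCast]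
    rw [hcast]
    gcongr
    exact (eLpNorm_translate_sub_le_modulus p _ h).trans (hC j hj _ (norm_pos_iff.2 hh))

theorem enorm_ofReal (a : ℝ) : ‖(a : ℂ)‖ₑ = ‖a‖ₑ := by
  rw [← ofReal_norm, ← ofReal_norm, Complex.norm_real]

/-- The approximation error of a smooth function by convolution with a kernel of total mass one
and vanishing moments up to the order `n`. -/
theorem eLpNorm_sub_integral_le {n : ℕ} (hn : 1 ≤ n) {θ : ℝ} (hθ : 0 < θ) {p : ℝ≥0∞} (hp : 1 ≤ p)
    {F : Plane → ℝ} (hF : ContDiff ℝ (⊤ : ℕ∞) F) (hFb : ∃ B, ∀ x, ‖F x‖ ≤ B)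
    {k : Plane → ℂ} (hk : Integrable k volume) (hk1 : ∫ y, k y = 1)
    (hmom : ∀ j₁ j₂ : ℕ, 1 ≤ j₁ + j₂ → j₁ + j₂ ≤ n →
      ∫ y : Plane, ((y 0 ^ j₁ * y 1 ^ j₂ : ℝ) : ℂ) * k y = 0)
    (hkα : Integrable (fun y => ‖y‖ ^ (n + θ : ℝ) * ‖k y‖) volume) {C : ℕ × ℕ → ℝ≥0∞}
    (hC : ∀ j ∈ Finset.HasAntidiagonal.antidiagonal n, ∀ t : ℝ, 0 < t →
      modulus p (mixedDeriv j F) t ≤ C j * ENNReal.ofReal (t ^ θ)) :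
    eLpNorm (fun x => (F x : ℂ) - ∫ y, (F (x - y) : ℂ) * k y) p volume ≤
      (∑ j ∈ Finset.HasAntidiagonal.antidiagonal n, (n.choose j.1 : ℝ≥0∞) * C j) *
        ENNReal.ofReal (Real.Gamma (θ + 1) / Real.Gamma (n + θ + 1) *
          ∫ y, ‖y‖ ^ (n + θ : ℝ) * ‖k y‖) := by
  obtain ⟨B, hB⟩ := hFb
  set m : Measure ℝ := volume.restrict (Set.Ioc 0 1) with hm
  -- Minkowski is applied on pairs `(y, t)`: the density `ρ` collects the Taylor weight and `|k|`,
  -- while the weight `w = ‖t y‖^θ` is the growth of the increments.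
  set ρ : Plane × ℝ → ℝ≥0∞ := fun z =>
    ENNReal.ofReal ((n.factorial : ℝ)⁻¹ * (n * (1 - z.2) ^ (n - 1)) * ‖z.1‖ ^ n) * ‖k z.1‖ₑ with hρ
  have hρm : AEMeasurable ρ (volume.prod m) := by
    have hc : Continuous fun z : Plane × ℝ =>
        (n.factorial : ℝ)⁻¹ * (n * (1 - z.2) ^ (n - 1)) * ‖z.1‖ ^ n := by fun_prop
    refine AEMeasurable.mul hc.measurable.ennreal_ofReal.aemeasurable ?_
    exact hk.aestronglyMeasurable.enorm.comp_fst
  set ν : Measure (Plane × ℝ) := (volume.prod m).withDensity ρ with hν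
  set w : Plane × ℝ → ℝ≥0∞ := fun z => ENNReal.ofReal (‖z.2 • z.1‖ ^ θ) with hw
  have hwm : Measurable w := by
    have : Continuous fun z : Plane × ℝ => ‖z.2 • z.1‖ ^ θ :=
      (Real.continuous_rpow_const hθ.le).comp (by fun_prop)
    exact this.measurable.ennreal_ofReal
  have hdc := continuous_derivIncrement hF n
  have hpt : ∀ x, ‖(F x : ℂ) - ∫ y, (F (x - y) : ℂ) * k y‖ₑ ≤
      ∫⁻ z, ‖derivIncrement n F x (z.2 • z.1)‖ₑ ∂ν := by
    intro x
    have hi1 : Integrable (fun y => (F (x - y) : ℂ) * k y) volume := by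
      refine hk.bdd_mul (c := B) ?_ (Filter.Eventually.of_forall fun y => ?_)
      · have := hF.continuous
        exact Continuous.aestronglyMeasurable (by fun_prop)
      · rw [Complex.norm_real]
        exact hB _
    have hdx : Continuous fun z : Plane × ℝ => derivIncrement n F x (z.2 • z.1) :=
      hdc.comp (by fun_prop : Continuous fun z : Plane × ℝ => (x, z.2 • z.1))
    -- Writing `F x` as the integral of its Taylor polynomial against `k` turns the error into the
    -- integrated remainder.
    rw [← integral_taylorPoly_mul (n := n) hF hθ.le hk hkα hk1 hmom x,
      ← integral_sub (integrable_taylorPoly_mul hF hθ.le hk hkα x) hi1]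
    refine (enorm_integral_le_lintegral_enorm _).trans ?_
    rw [hν, lintegral_withDensity_eq_lintegral_mul₀ hρm hdx.measurable.enorm.aemeasurable,
      lintegral_prod _ (hρm.mul hdx.measurable.enorm.aemeasurable)]
    refine lintegral_mono fun y => ?_
    rw [← sub_mul, enorm_mul, ← Complex.ofReal_sub, enorm_ofReal, enorm_sub_rev]
    refine (mul_le_mul_left (enorm_sub_taylorPoly_le hF hn x y) _).trans ?_
    rw [← lintegral_mul_const' _ _ enorm_ne_top]
    refine lintegral_mono fun t => ?_
    simp only [Pi.mul_apply, hρ]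
    rw [mul_right_comm]
  have hac : ν ≪ volume.prod m := withDensity_absolutelyContinuous _ _
  -- Both the positivity of the weight and the modulus bound require a nonzero increment; `y = 0`
  -- and `t = 0` are negligible.
  have hne : ∀ᵐ z ∂ν, z.2 • z.1 ≠ 0 := by
    refine hac.ae_le ?_
    have h1 : ∀ᵐ z ∂((volume : Measure Plane).prod m), z.1 ≠ 0 :=
      Measure.quasiMeasurePreserving_fst.ae (Measure.ae_ne volume 0)
    have h2 : ∀ᵐ z ∂((volume : Measure Plane).prod m), z.2 ∈ Set.Ioc (0 : ℝ) 1 :=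
      Measure.quasiMeasurePreserving_snd.ae (ae_restrict_mem measurableSet_Ioc)
    filter_upwards [h1, h2] with z hz1 hz2
    exact smul_ne_zero hz2.1.ne' hz1
  have hmass : ∫⁻ z, w z ∂ν = ENNReal.ofReal (Real.Gamma (θ + 1) / Real.Gamma (n + θ + 1) *
      ∫ y, ‖y‖ ^ (n + θ : ℝ) * ‖k y‖) := by
    have e : ∀ᵐ z ∂((volume : Measure Plane).prod m), (ρ * w) z =
        ENNReal.ofReal (‖z.1‖ ^ (n + θ : ℝ) * ‖k z.1‖) * (ENNReal.ofReal (n.factorial : ℝ)⁻¹ *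
          ENNReal.ofReal (n * (1 - z.2) ^ (n - 1) * z.2 ^ θ)) := by
      have h2 : ∀ᵐ z ∂((volume : Measure Plane).prod m), z.2 ∈ Set.Ioc (0 : ℝ) 1 :=
        Measure.quasiMeasurePreserving_snd.ae (ae_restrict_mem measurableSet_Ioc)
      filter_upwards [h2] with z hz
      have h0 : 0 ≤ (1 - z.2) ^ (n - 1) := pow_nonneg (sub_nonneg.2 hz.2) _
      have h1 : 0 ≤ ‖z.1‖ ^ (n + θ : ℝ) := Real.rpow_nonneg (norm_nonneg _) _
      have h3 : 0 ≤ z.2 ^ θ := Real.rpow_nonneg hz.1.le _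
      simp only [Pi.mul_apply, hρ, hw]
      rw [← ofReal_norm (k z.1), ← ENNReal.ofReal_mul (by positivity),
        ← ENNReal.ofReal_mul (by positivity), ← ENNReal.ofReal_mul (by positivity),
        ← ENNReal.ofReal_mul (by positivity), norm_smul, Real.norm_of_nonneg hz.1.le,
        Real.mul_rpow hz.1.le (norm_nonneg _),
        Real.rpow_add_of_nonneg (norm_nonneg _) (Nat.cast_nonneg n) hθ.le, Real.rpow_natCast]
      congr 1
      ring
    have hkm : AEMeasurable (fun y => ENNReal.ofReal (‖y‖ ^ (n + θ : ℝ) * ‖k y‖)) volume :=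
      hkα.aestronglyMeasurable.aemeasurable.ennreal_ofReal
    have htm : Measurable fun t : ℝ => ENNReal.ofReal (n * (1 - t) ^ (n - 1) * t ^ θ) := by
      have h1 : Continuous fun s : ℝ => s ^ θ := Real.continuous_rpow_const hθ.le
      have h2 : Continuous fun t : ℝ => n * (1 - t) ^ (n - 1) * t ^ θ := by fun_prop
      exact h2.measurable.ennreal_ofReal
    have hΓ : 0 ≤ Real.Gamma (θ + 1) / Real.Gamma (n + θ + 1) := by
      have h1 := Real.Gamma_pos_of_pos (s := θ + 1) (by linarith)
      have h2 := Real.Gamma_pos_of_pos (s := n + θ + 1) (by positivity)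
      positivity
    rw [hν, lintegral_withDensity_eq_lintegral_mul₀ hρm hwm.aemeasurable, lintegral_congr_ae e,
      lintegral_prod_mul hkm (htm.const_mul _).aemeasurable,
      lintegral_const_mul _ htm, lintegral_one_sub_pow_mul_rpow hn hθ,
      ← ofReal_integral_eq_lintegral_ofReal hkα (Filter.Eventually.of_forall fun y => by positivity),
      ← ENNReal.ofReal_mul (by positivity), mul_comm, ← ENNReal.ofReal_mul (by positivity)]
    congr 2
    have : (n.factorial : ℝ) ≠ 0 := by positivity
    field_simp
  rw [← hmass]
  calc _ ≤ eLpNorm (fun x => ∫⁻ z, ‖derivIncrement n F x (z.2 • z.1)‖ₑ ∂ν) p volume :=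
        eLpNorm_mono_enorm fun x => by simpa using hpt x
    _ ≤ _ := by
        refine eLpNorm_lintegral_le hp ?_ hwm.aemeasurable ?_ (by simp [hw]) ?_
        · have : Continuous fun q : Plane × Plane × ℝ => derivIncrement n F q.1 (q.2.2 • q.2.1) :=
            hdc.comp (by fun_prop : Continuous fun q : Plane × Plane × ℝ => (q.1, q.2.2 • q.2.1))
          exact this.measurable.enorm.aemeasurable
        · filter_upwards [hne] with z hz
          simp only [hw, ne_eq, ENNReal.ofReal_eq_zero, not_le]
          exact Real.rpow_pos_of_pos (norm_pos_iff.2 hz) _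
        · filter_upwards [hne] with z hz
          rw [eLpNorm_enorm]
          exact eLpNorm_derivIncrement_le hF hp hC hz

/-! ### Scaling of the kernel -/

section Scaling

variable {W : ℝ → ℝ} {L : ℝ}

theorem integral_comp_smul_plane {E : Type*} [NormedAddCommGroup E] [NormedSpace ℝ E] (hL : 0 < L)
    (G : Plane → E) : ∫ y, G (L • y) = (L ^ 2)⁻¹ • ∫ y, G y := by
  rw [Measure.integral_comp_smul, finrank_euclideanSpace, Fintype.card_fin,
    abs_of_pos (by positivity)]

theorem integrable_kernel (hL : 0 < L) (hK : Integrable (kernel W 1) volume) :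
    Integrable (kernel W L) volume := by
  rw [show kernel W L = fun x => (L : ℂ) ^ 2 * kernel W 1 (L • x) from funext (kernel_eq W hL)]
  exact (hK.comp_smul hL.ne').const_mul _

theorem integral_kernel_eq (hL : 0 < L) : ∫ y, kernel W L y = ∫ y, kernel W 1 y := by
  simp only [kernel_eq W hL]
  rw [integral_const_mul, integral_comp_smul_plane hL, Complex.real_smul]
  have hLc : (L : ℂ) ≠ 0 := Complex.ofReal_ne_zero.2 hL.ne'
  push_cast
  field_simp

theorem integral_monomial_mul_kernel (hL : 0 < L) {a b : ℕ}
    (h : ∫ y : Plane, ((y 0 ^ a * y 1 ^ b : ℝ) : ℂ) * kernel W 1 y = 0) :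
    ∫ y : Plane, ((y 0 ^ a * y 1 ^ b : ℝ) : ℂ) * kernel W L y = 0 := by
  have e : ∀ y : Plane, ((y 0 ^ a * y 1 ^ b : ℝ) : ℂ) * kernel W L y =
      ((L : ℂ) ^ 2 * ((L : ℂ) ^ (a + b))⁻¹) *
        ((((L • y) 0 ^ a * (L • y) 1 ^ b : ℝ) : ℂ) * kernel W 1 (L • y)) := by
    intro y
    have hLc : (L : ℂ) ≠ 0 := Complex.ofReal_ne_zero.2 hL.ne'
    rw [kernel_eq W hL]
    simp only [PiLp.smul_apply, smul_eq_mul]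
    push_cast
    rw [mul_pow, mul_pow, pow_add]
    field_simp
  simp only [e]
  rw [integral_const_mul, integral_comp_smul_plane hL
    (fun y : Plane => ((y 0 ^ a * y 1 ^ b : ℝ) : ℂ) * kernel W 1 y), h, smul_zero, mul_zero]

theorem norm_rpow_mul_norm_kernel (hL : 0 < L) (α : ℝ) (y : Plane) :
    ‖y‖ ^ α * ‖kernel W L y‖ = (L ^ 2 * L ^ (-α)) * (‖L • y‖ ^ α * ‖kernel W 1 (L • y)‖) := by
  rw [kernel_eq W hL, norm_mul, norm_pow, Complex.norm_real, norm_smul,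
    Real.mul_rpow (norm_nonneg _) (norm_nonneg _), Real.norm_of_nonneg hL.le, Real.rpow_neg hL.le]
  have := (Real.rpow_pos_of_pos hL α).ne'
  field_simp

theorem integrable_rpow_mul_kernel (hL : 0 < L) {α : ℝ}
    (h : Integrable (fun y : Plane => ‖y‖ ^ α * ‖kernel W 1 y‖) volume) :
    Integrable (fun y : Plane => ‖y‖ ^ α * ‖kernel W L y‖) volume := by
  simp only [norm_rpow_mul_norm_kernel hL α]
  exact (h.comp_smul hL.ne').const_mul _

theorem integral_rpow_mul_kernel (hL : 0 < L) (α : ℝ) :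
    ∫ y : Plane, ‖y‖ ^ α * ‖kernel W L y‖
      = (∫ y : Plane, ‖y‖ ^ α * ‖kernel W 1 y‖) * L ^ (-α) := by
  simp only [norm_rpow_mul_norm_kernel hL α]
  rw [integral_const_mul,
    integral_comp_smul_plane hL (fun y : Plane => ‖y‖ ^ α * ‖kernel W 1 y‖), smul_eq_mul]
  field_simp

end Scaling

/-! ### Mollification of the error -/

section Error

variable {φ f : Plane → ℝ} {k : Plane → ℂ}

/-- Convolution of a real-valued with a complex-valued function on the plane. -/
noncomputable abbrev convC (φ : Plane → ℝ) (k : Plane → ℂ) : Plane → ℂ :=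
  φ ⋆[ContinuousLinearMap.lsmul ℝ ℝ, volume] k

theorem convC_apply (φ : Plane → ℝ) (k : Plane → ℂ) (x : Plane) :
    convC φ k x = ∫ y, (φ y : ℂ) * k (x - y) := by
  simp [convC, convolution]

theorem convC_apply_swap (φ : Plane → ℝ) (k : Plane → ℂ) (x : Plane) :
    convC φ k x = ∫ y, (φ (x - y) : ℂ) * k y := by
  rw [convC, convolution_eq_swap]
  simp

/-- With associativity, mollifying the error of `f` is the same as taking the error of the mollified
`f`, as used in `convC_sub`. -/
theorem convC_assoc (hφ : Continuous φ) (hc : HasCompactSupport φ) (hf : Integrable f volume)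
    (hk : Integrable k volume) (x : Plane) :
    convC (conv φ f) k x = convC φ (convC f k) x := by
  refine convolution_assoc _ _ _ _ (fun a b z => ?_) hφ.aestronglyMeasurable
    hf.aestronglyMeasurable hk.aestronglyMeasurable ?_ ?_ ?_
  · simp [mul_smul]
  · exact Filter.Eventually.of_forall (hc.convolutionExists_left _ hφ hf.locallyIntegrable)
  · exact hf.norm.ae_convolution_exists _ hk.norm
  · exact hc.norm.convolutionExists_left _ hφ.norm
      (hf.norm.integrable_convolution _ hk.norm).locallyIntegrable x

theorem convC_sub (hφ : Continuous φ) (hc : HasCompactSupport φ) (hf : Integrable f volume)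
    (hk : Integrable k volume) (x : Plane) :
    convC φ (fun x => (f x : ℂ) - convC f k x) x
      = (conv φ f x : ℂ) - ∫ y, (conv φ f (x - y) : ℂ) * k y := by
  have h1 : Integrable (fun y => (φ y : ℂ) * (f (x - y) : ℂ)) volume := by
    have := (hc.convolutionExists_left (ContinuousLinearMap.lsmul ℝ ℝ) hφ
      hf.locallyIntegrable x).ofReal (𝕜 := ℂ)
    simpa using this
  have h2 : Integrable (fun y => (φ y : ℂ) * convC f k (x - y)) volume := by
    have := hc.convolutionExists_left (ContinuousLinearMap.lsmul ℝ ℝ) hφ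
      (hf.integrable_convolution (ContinuousLinearMap.lsmul ℝ ℝ) hk).locallyIntegrable x
    simpa [ConvolutionExistsAt] using this
  rw [← convC_apply_swap, convC_assoc hφ hc hf hk, convC_apply, convC_apply]
  simp only [mul_sub]
  rw [integral_sub h1 h2]
  congr 1
  rw [conv_apply, ← integral_complex_ofReal]
  simp

end Error

/-! ### From mollifications to the function itself, and the theorem -/

/-- The moduli of continuity of the derivatives of a mollification are controlled by the Besov
semi-norms of the weak derivatives. -/
theorem modulus_mixedDeriv_conv_le {θ : ℝ} (hθ : 0 < θ) {p q : ℝ≥0∞} (hp : 1 ≤ p) (hq : 1 ≤ q)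
    {φ f : Plane → ℝ} (hφ : ContDiff ℝ (⊤ : ℕ∞) φ) (hc : HasCompactSupport φ)
    (h0 : ∀ x, 0 ≤ φ x) (h1 : ∫ x, φ x = 1) (hf : LocallyIntegrable f volume) (j : ℕ × ℕ)
    {t : ℝ} (ht : 0 < t) :
    modulus p (mixedDeriv j (conv φ f)) t ≤ (ENNReal.ofReal (besovConst θ q) *
      ⨅ (g : Plane → ℝ) (_ : IsWeakDeriv j f g), besovSeminormFrac θ p q g) *
        ENNReal.ofReal (t ^ θ) := by
  have hb := besovConst_pos hθ hq
  have htθ := Real.rpow_pos_of_pos ht θ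
  -- A factor that is neither zero nor infinite passes through the infimum over representatives,
  -- including the empty infimum `∞`.
  have hpos : ENNReal.ofReal (besovConst θ q * t ^ θ) ≠ 0 := by
    rw [ne_eq, ENNReal.ofReal_eq_zero, not_le]
    positivity
  rw [mul_right_comm, ← ENNReal.ofReal_mul hb.le, ENNReal.mul_iInf_of_ne hpos ENNReal.ofReal_ne_top]
  refine le_iInf fun g => ?_
  rw [ENNReal.mul_iInf_of_ne hpos ENNReal.ofReal_ne_top]
  refine le_iInf fun hg => ?_
  rw [hg.mixedDeriv_conv hφ hc hf]
  exact (modulus_conv_le hp hφ.continuous hc h0 h1 hg.1 t).trans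
    (modulus_le_besovSeminormFrac hθ hq g ht)

open Filter Topology in
/-- An integrable function is approximated in `L^p` by its convolution with a kernel of total mass
one and vanishing moments, with a rate given by its Besov semi-norm. -/
theorem eLpNorm_sub_convC_le {n : ℕ} (hn : 1 ≤ n) {θ : ℝ} (hθ : 0 < θ) {p q : ℝ≥0∞} (hp : 1 ≤ p)
    (hq : 1 ≤ q) {f : Plane → ℝ} (hf : Integrable f volume)
    {k : Plane → ℂ} (hk : Integrable k volume) (hk1 : ∫ y, k y = 1)
    (hmom : ∀ j₁ j₂ : ℕ, 1 ≤ j₁ + j₂ → j₁ + j₂ ≤ n →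
      ∫ y : Plane, ((y 0 ^ j₁ * y 1 ^ j₂ : ℝ) : ℂ) * k y = 0)
    (hkα : Integrable (fun y => ‖y‖ ^ (n + θ : ℝ) * ‖k y‖) volume) :
    eLpNorm (fun x => (f x : ℂ) - convC f k x) p volume ≤
      ENNReal.ofReal (besovConst θ q * (Real.Gamma (θ + 1) / Real.Gamma (n + θ + 1)) *
        ∫ y, ‖y‖ ^ (n + θ : ℝ) * ‖k y‖) * besovSeminorm n θ p q f := by
  have hg : Integrable (fun x => (f x : ℂ) - convC f k x) volume :=
    hf.ofReal.sub (hf.integrable_convolution _ hk)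
  set φ : ℕ → ContDiffBump (0 : Plane) := fun i =>
    ⟨1 / ((i : ℝ) + 1), 2 * (1 / ((i : ℝ) + 1)), by positivity, by
      have : 0 < 1 / ((i : ℝ) + 1) := by positivity
      linarith⟩ with hφ
  -- Lebesgue differentiation: the outer radii shrink to zero with fixed ratio `2` to the inner
  -- ones, so the mollified error converges almost everywhere.
  have hlim := ContDiffBump.ae_convolution_tendsto_right_of_locallyIntegrable (μ := volume)
    (φ := φ) (l := atTop) (K := 2)
    (by simpa [hφ] using tendsto_one_div_add_atTop_nhds_zero_nat.const_mul (2 : ℝ))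
    (Eventually.of_forall fun i => le_rfl) hg.locallyIntegrable
  have hc : ∀ i, HasCompactSupport ((φ i).normed volume) := fun i =>
    (φ i).hasCompactSupport_normed
  have hs : ∀ i, ContDiff ℝ (⊤ : ℕ∞) ((φ i).normed volume) := fun i => (φ i).contDiff_normed
  have hΓ : 0 ≤ Real.Gamma (θ + 1) / Real.Gamma (n + θ + 1) := by
    have h1 := Real.Gamma_pos_of_pos (s := θ + 1) (by linarith)
    have h2 := Real.Gamma_pos_of_pos (s := n + θ + 1) (by positivity)
    positivity
  -- Fatou: the bound for the mollified errors does not depend on `i`, so it passes to the almost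
  -- everywhere limit for every `p`, including `∞`.
  refine Lp.eLpNorm_le_of_ae_tendsto (u := atTop) (Eventually.of_forall fun i => ?_) (fun i => ?_)
    hlim
  · have e : convC ((φ i).normed volume) (fun x => (f x : ℂ) - convC f k x) = fun x =>
        (conv ((φ i).normed volume) f x : ℂ) - ∫ y, (conv ((φ i).normed volume) f (x - y) : ℂ) * k y :=
      funext (convC_sub (hs i).continuous (hc i) hf hk)
    refine (congrArg (fun u => eLpNorm u p volume) e).trans_le ?_
    refine (eLpNorm_sub_integral_le hn hθ hp (contDiff_conv (hs i) (hc i) hf.locallyIntegrable)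
      (norm_conv_le (hs i).continuous (hc i) hf) hk hk1 hmom hkα fun j _ t ht =>
        modulus_mixedDeriv_conv_le hθ hp hq (hs i) (hc i) (fun x => (φ i).nonneg_normed x)
          ((φ i).integral_normed) hf.locallyIntegrable j ht).trans_eq ?_
    rw [besovSeminorm, mul_assoc (besovConst θ q),
      ENNReal.ofReal_mul (besovConst_pos hθ hq).le, Finset.sum_mul, Finset.mul_sum]
    refine Finset.sum_congr rfl fun j _ => ?_
    ring
  · exact (((hc i).contDiff_convolution_left (n := 0) _ ((hs i).of_le (by simp))
      hg.locallyIntegrable).continuous).aestronglyMeasurable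

end FBP

theorem mainTheorem2
    (n : ℕ) (hn : 1 ≤ n) (θ : ℝ) (hθ0 : 0 < θ) (hθ1 : θ < 1) (α : ℝ) (hα : α = n + θ)
    (p q : ℝ≥0∞) (hp : 1 ≤ p) (hq : 1 ≤ q)
    (f : FBP.Plane → ℝ) (hf1 : MemLp f 1 volume) (hf : FBP.MemBesov n θ p q f)
    (W : ℝ → ℝ) (hW : MemLp W ∞ volume) (hWeven : Function.Even W)
    (hW0 : W 0 = 1) (hWcont : ContinuousAt W 0)
    (hA1 : MemLp (FBP.lowPass W 1) 1 volume) (hA2 : MemLp (FBP.lowPass W 1) 2 volume)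
    (hK : Integrable (FBP.kernel W 1) volume)
    (hmom : ∀ j₁ j₂ : ℕ, 1 ≤ j₁ + j₂ → j₁ + j₂ ≤ n →
      ∫ x : FBP.Plane, ((x 0 ^ j₁ * x 1 ^ j₂ : ℝ) : ℂ) * FBP.kernel W 1 x = 0)
    (hKα : Integrable (fun x : FBP.Plane => ‖x‖ ^ α * ‖FBP.kernel W 1 x‖) volume)
    (L : ℝ) (hL : 0 < L) :
    MemLp (fun x => (f x : ℂ) - FBP.fbp W L f x) p volume ∧
      eLpNorm (fun x => (f x : ℂ) - FBP.fbp W L f x) p volume ≤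
        ENNReal.ofReal
          (FBP.besovConst θ q * (Real.Gamma (θ + 1) / Real.Gamma (α + 1)) *
            (∫ x : FBP.Plane, ‖x‖ ^ α * ‖FBP.kernel W 1 x‖) * L ^ (-α)) *
          FBP.besovSeminorm n θ p q f := by
  have hfi : Integrable f volume := memLp_one_iff_integrable.1 hf1
  have hA : Integrable (FBP.lowPass W 1) volume := memLp_one_iff_integrable.1 hA1
  have hKL := FBP.integrable_kernel hL hK
  have hfbp : FBP.fbp W L f = FBP.convC f (FBP.kernel W L) := by
    ext x
    rw [FBP.fbp_eq_integral (FBP.integrable_lowPass hA hL) hfi, FBP.convC_apply]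
  subst hα
  have hbound := FBP.eLpNorm_sub_convC_le hn hθ0 hp hq hfi hKL
    ((FBP.integral_kernel_eq hL).trans (FBP.integral_kernel hW hW0 hWcont hA hK))
    (fun a b h1 h2 => FBP.integral_monomial_mul_kernel hL (hmom a b h1 h2))
    (FBP.integrable_rpow_mul_kernel hL hKα)
  rw [FBP.integral_rpow_mul_kernel hL, ← mul_assoc] at hbound
  rw [hfbp]
  -- Membership in `L^p` follows from the bound itself, whose right side is finite because the Besov
  -- semi-norm is.
  refine ⟨⟨?_, hbound.trans_lt (ENNReal.mul_lt_top ENNReal.ofReal_lt_top hf.2)⟩, hbound⟩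
  exact (hfi.ofReal.sub (hfi.integrable_convolution _ hKL)).aestronglyMeasurable
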